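/- **Setting.** Let $A$ be a randomized algorithm on databases and let $x,x'$ be two databases. Either $A$ is *discrete*: its outputs lie in a set $\mathcal Y\subset\mathbb N$ and $f_x(t)=\mathbb P(A(x)=t)$; or $A$ is *continuous*: $\mathcal Y=\mathbb R^d$ and, for every $x$, $A(x)$ has a continuous density $f_x$. Put $\ell_{x,x'}(t)=|\ln f_x(t)-\ln f_{x'}(t)|\in[0,\infty]$ (with $\ln 0=-\infty$, $\infty-\infty:=0$), let $C\subset\mathcal Y$ be closed and bounded, and let $\epsilon_{x,x',C}=\sup_{t\in C}\ell_{x,x'}(t)$. For each $n$, let $X_1,\dots,X_n\sim f_x$ and $Y_1,\dots,Y_n\sim f_{x'}$ be two independent i.i.d. samples. For a floor $\tau=\tau_n>0$ let, in the discrete case, $\hat f_x(t)=\max\{|\{i:X_i=t\}|/n,\ \tau\}$, and likewise $\hat f_{x'}$ with the $Y_i$; in the continuous case, for bandwidths $h=h_n>0$, $h'=h'_n>0$, let $\hat f_x(t)=\max\{\frac1{nh^d}\sum_{i=1}^nK(\frac{t-X_i}{h}),\ \tau\}$, and likewise $\hat f_{x'}$ with $h'$ and the $Y_i$. Here $K\ge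 0$ is a continuous function on $\mathbb R^d$ with $\int K=1$ and $K(u)=k(|u|)$ for a non-increasing $k:[0,\infty)\to[0,\infty)$ such that $k(t)\le C_\rho e^{-t^\rho}$ for all $t>t_0$, for some $\rho,C_\rho,t_0>0$. Let $\hat\ell_{x,x'}(t)=|\ln\hat f_x(t)-\ln\hat f_{x'}(t)|$, let $\hat t=\hat t_n\in\operatorname{argmax}_{t\in C}\hat\ell_{x,x'}(t)$ and $\hat\epsilon_{x,x'}=\hat\ell_{x,x'}(\hat t)$. **Conditions.** - (D) $\tau=O(\ln(n)/\sqrt n)$. - (C1) For some $\beta\in(0,1]$, every density $f_x$ is $\beta$-Hölder continuous on $\mathbb R^d$. - (C2) For all $x,x'$, every sequence $(t_n)$ in $C$ with $\ell_{x,x'}(t_n)\to\sup_{t\in C}\ell_{x,x'}(t)$ has a limit point in $\operatorname{argmax}_{t\in C}\ell_{x,x'}(t)$. - (C3) $h$ and $h'$ are of exact order $n^{-1/(2\beta+d)}$ (bounded above and below, eventually, by positive multiples of it); $\tau=O(n^{-\beta/(2\beta+d)}\ln n)$, and $\sqrt{\ln n}\,n^{-\beta/(2\beta+d)}=o(\tau)$.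 **Proposition.** $Z_n=O_P(a_n)$ means that for every $\varepsilon>0$ there is $c>0$ with $\limsup_n\mathbb P(|Z_n|/a_n\ge c)<\varepsilon$. 1. If $\epsilon_{x,x',C}\in(0,\infty)$, $A$ is discrete and (D) holds, then $$|\hat\epsilon_{x,x'}-\epsilon_{x,x',C}|=O_P(n^{-1/2})\quad\text{and}\quad|\ell_{x,x'}(\hat t)-\epsilon_{x,x',C}|=O_P(n^{-1/2}).$$ 2. If $\epsilon_{x,x',C}\in(0,\infty)$, $A$ is continuous and (C1)–(C3) hold, then $$|\hat\epsilon_{x,x'}-\epsilon_{x,x',C}|=O_P\big(\sqrt{\ln n}\;n^{-\frac{\beta}{2\beta+d}}\big)\quad\text{and}\quad|\ell_{x,x'}(\hat t)-\epsilon_{x,x',C}|=O_P\big(\sqrt{\ln n}\;n^{-\frac{\beta}{2\beta+d}}\big).$$ 3. If $A$ is discrete and (D) holds, or $A$ is continuous and (C1)–(C3) hold, then $\epsilon_{x,x',C}=0$ implies that $\hat\epsilon_{x,x'}\to0$ in probability, and $\epsilon_{x,x',C}=\infty$ implies that $\mathbb P(\hat\epsilon_{x,x'}\ge c)\to1$ for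 every $c>0$. -/

import Mathlib

open MeasureTheory ProbabilityTheory Filter Topology Asymptotics
open scoped ENNReal NNReal

namespace LocalDP

noncomputable section

/-- Euclidean space `ℝ^d` with the Euclidean norm. -/
abbrev E (d : ℕ) : Type := EuclideanSpace ℝ (Fin d)

/-! ### Stochastic convergence -/

/-- `Z n = O_P(a n)`: for every `ε > 0` there is `c > 0` with
`limsup P(|Z n| / a n ≥ c) < ε`. -/
def IsBigOP {Ω : Type*} [MeasurableSpace Ω] (P : Measure Ω)
    (Z : ℕ → Ω → ℝ) (a : ℕ → ℝ) : Prop :=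
  ∀ ε : ℝ, 0 < ε → ∃ c : ℝ, 0 < c ∧
    limsup (fun n => P {ω | c ≤ |Z n ω| / a n}) atTop < ENNReal.ofReal ε

/-- Divergence to infinity in probability: `P(Z n ≥ c) → 1` for every `c > 0`. -/
def TendstoInProbTop {Ω : Type*} [MeasurableSpace Ω] (P : Measure Ω)
    (Z : ℕ → Ω → ℝ) : Prop :=
  ∀ c : ℝ, 0 < c → Tendsto (fun n => P {ω | c ≤ Z n ω}) atTop (𝓝 1)

/-! ### The loss function -/

/-- `|ln a - ln b|` for `a, b ≥ 0`, with values in `[0, ∞]`, where `ln 0 = -∞` and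
`∞ - ∞ := 0`. -/
def logDist (a b : ℝ) : ℝ≥0∞ :=
  open Classical in
  if a = 0 ∧ b = 0 then 0
  else if a = 0 ∨ b = 0 then ∞
  else ENNReal.ofReal |Real.log a - Real.log b|

/-- The loss function `ℓ(t) = |ln f(t) - ln g(t)|` of two densities. -/
def loss {𝒴 : Type*} (f g : 𝒴 → ℝ) (t : 𝒴) : ℝ≥0∞ :=
  logDist (f t) (g t)

/-- The maximum privacy violation on `C`: the supremum over `t ∈ C` of the loss. -/
def maxLoss {𝒴 : Type*} (f g : 𝒴 → ℝ) (C : Set 𝒴) : ℝ≥0∞ :=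
  ⨆ t ∈ C, loss f g t

/-- The empirical loss `|ln f̂(t) - ln ĝ(t)|` of two (strictly positive) density
estimators. -/
def empLoss {𝒴 : Type*} (fhat ghat : 𝒴 → ℝ) (t : 𝒴) : ℝ :=
  |Real.log (fhat t) - Real.log (ghat t)|

/-- `t` is a point of `C` at which `L` attains its maximum over `C`. -/
def IsArgmaxOn {𝒴 R : Type*} [Preorder R] (L : 𝒴 → R) (C : Set 𝒴) (t : 𝒴) : Prop :=
  t ∈ C ∧ IsMaxOn L C t

/-! ### Samples and algorithms -/

/-- `X 0, …, X (n-1)` and `Y 0, …, Y (n-1)` are two independent samples of i.i.d. random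
variables, with laws `ν` and `ν'` respectively. -/
structure IsSamplePair {Ω 𝒴 : Type*} [MeasurableSpace Ω] [MeasurableSpace 𝒴]
    (P : Measure Ω) (ν ν' : Measure 𝒴) {n : ℕ} (X Y : Fin n → Ω → 𝒴) : Prop where
  measurable_fst : ∀ i, Measurable (X i)
  measurable_snd : ∀ i, Measurable (Y i)
  law_fst : ∀ i, P.map (X i) = ν
  law_snd : ∀ i, P.map (Y i) = ν'
  indep : iIndepFun (Sum.elim X Y) P

/-- The discrete density `f_x(t) = P(A(x) = t)` of an algorithm with outputs in `ℕ`,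
given through the law `A x` of its output on each database `x`. -/
def discreteDensity {𝒳 : Type*} (A : 𝒳 → Measure ℕ) (x : 𝒳) (t : ℕ) : ℝ :=
  (A x).real {t}

/-- `A` is a continuous algorithm with densities `f`: on each database `x` the output has
the continuous density `f x` with respect to Lebesgue measure on `ℝ^d`. -/
structure IsContinuousAlgorithm {𝒳 : Type*} {d : ℕ}
    (A : 𝒳 → Measure (E d)) (f : 𝒳 → E d → ℝ) : Prop where
  continuous : ∀ x, Continuous (f x)
  nonneg : ∀ x t, 0 ≤ f x t
  law_eq : ∀ x, A x = (volume : Measure (E d)).withDensity (fun t => ENNReal.ofReal (f x t))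

/-! ### Truncated density estimators -/

/-- Truncated relative frequency estimator with floor `τ`. -/
def tdde {n : ℕ} (X : Fin n → ℕ) (τ : ℝ) (t : ℕ) : ℝ :=
  max (((Finset.univ.filter (fun i => X i = t)).card : ℝ) / n) τ

/-- Kernel density estimator with kernel `K` and bandwidth `h`. -/
def kde {d n : ℕ} (K : E d → ℝ) (X : Fin n → E d) (h : ℝ) (t : E d) : ℝ :=
  1 / (n * h ^ d) * ∑ i, K (h⁻¹ • (t - X i))

/-- Truncated kernel density estimator with floor `τ`. -/
def tkde {d n : ℕ} (K : E d → ℝ) (X : Fin n → E d) (h τ : ℝ) (t : E d) : ℝ :=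
  max (kde K X h t) τ

/-- A kernel: a continuous probability density on `ℝ^d` that is spherically symmetric,
`K u = k |u|` with `k` non-increasing on `[0, ∞)`, and has exponentially decaying tails. -/
structure IsKernel {d : ℕ} (K : E d → ℝ) : Prop where
  continuous : Continuous K
  nonneg : ∀ u, 0 ≤ K u
  integral_eq_one : ∫ u, K u = 1
  radial_tails : ∃ k : ℝ → ℝ, AntitoneOn k (Set.Ici 0) ∧ (∀ r, 0 ≤ r → 0 ≤ k r) ∧
    (∀ u, K u = k ‖u‖) ∧
    ∃ ρ Cρ t₀ : ℝ, 0 < ρ ∧ 0 < Cρ ∧ 0 < t₀ ∧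
      ∀ t, t₀ < t → k t ≤ Cρ * Real.exp (-(t ^ ρ))

/-! ### Regularity conditions -/

/-- Discrete case: the floors are positive with `τ = O(ln n / √n)`. -/
def CondD (τ : ℕ → ℝ) : Prop :=
  (∀ n, 0 < τ n) ∧ τ =O[atTop] (fun n : ℕ => Real.log n / √(n : ℝ))

/-- All densities of the algorithm are `β`-Hölder continuous, where `β ∈ (0, 1]`. -/
def CondC1 {𝒳 : Type*} {d : ℕ} (f : 𝒳 → E d → ℝ) (β : ℝ≥0) : Prop :=
  0 < β ∧ β ≤ 1 ∧ ∀ x, ∃ L : ℝ≥0, HolderWith L β (f x)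

/-- Every maximizing sequence in `C` of a loss function has a limit point (that is, a
cluster point) in the argmax of this loss function over `C`. -/
def CondC2 {𝒳 : Type*} {d : ℕ} (f : 𝒳 → E d → ℝ) (C : Set (E d)) : Prop :=
  ∀ x x' : 𝒳, ∀ u : ℕ → E d, (∀ n, u n ∈ C) →
    Tendsto (fun n => loss (f x) (f x') (u n)) atTop (𝓝 (maxLoss (f x) (f x') C)) →
    ∃ t, IsArgmaxOn (loss (f x) (f x')) C t ∧ MapClusterPt t atTop u

/-- The rate `√(ln n) · n^(-β/(2β+d))` of uniform kernel density estimation. -/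
def contRate (d : ℕ) (β : ℝ≥0) (n : ℕ) : ℝ :=
  √(Real.log n) * (n : ℝ) ^ (-((β : ℝ) / (2 * β + d)))

/-- The bandwidths are positive and of exact order `n^(-1/(2β+d))`; the floors are positive,
`O(n^(-β/(2β+d)) ln n)`, and of larger order than the precision
`√(ln n) n^(-β/(2β+d))` of the density estimators. -/
structure CondC3 (d : ℕ) (β : ℝ≥0) (h h' τ : ℕ → ℝ) : Prop where
  h_pos : ∀ n, 0 < h n
  h'_pos : ∀ n, 0 < h' n
  τ_pos : ∀ n, 0 < τ n
  h_order : h =Θ[atTop] (fun n : ℕ => (n : ℝ) ^ (-(1 / (2 * (β : ℝ) + d))))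
  h'_order : h' =Θ[atTop] (fun n : ℕ => (n : ℝ) ^ (-(1 / (2 * (β : ℝ) + d))))
  τ_upper : τ =O[atTop] (fun n : ℕ => (n : ℝ) ^ (-((β : ℝ) / (2 * β + d))) * Real.log n)
  τ_lower : contRate d β =o[atTop] τ

end

end LocalDP

/-!
For each pair of databases, the estimated maximum loss `|ln f̂ - ln ĝ|` is compared with the true
one through events of probability close to one on which both density estimators, before
truncation, are uniformly precise on `C`: up to `M n^(-1/2)` for relative frequencies and up to
`M contRate` for kernel estimators.

*Precision.* Both estimators are averages of bounded functions of an i.i.d. sample, so a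
Bernstein-type inequality (`measure_abs_sum_sub_ge_le`) applies pointwise. A bounded set of
natural numbers is finite, which settles the discrete case. For kernel estimators
(`exists_tendsto_measure_kde_deviation`) the supremum over `C` is reduced to a grid of polynomially
many points. The kernel need not have any modulus of continuity beyond being continuous, but it is
a non-increasing function of the norm. Hence all translates of `K (· / h)` by at most `δ² h` lie
between two explicit functions, namely dilations of `K` by `1 ± δ` corrected on a ball of radius
`δ h` (`bracket_le_le_bracket`), whose Lebesgue integrals differ from that of `K (· / h)` only by
`O(δ h^d)`. With `δ = 1/n` this is negligible, the Hölder condition bounds the bias by `O(h^β)`,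
and the exponential bound with parameter `contRate` makes the failure probability at a grid point
`O(n^(-q))` for any prescribed `q`, once the precision constant `M` is large.

*From densities to losses.* Where both densities are bounded away from zero, the truncation at `τ`
is inactive and the logarithm is Lipschitz, so that the loss inherits the precision of the density
estimators (`abs_abs_log_max_sub_le`). Elsewhere the empirical loss may be far from the loss, but
cannot exceed it by much: truncating does not increase log-ratios, and the estimation error is
`o(τ)` (`abs_log_max_sub_log_max_le_add`; in the discrete case values of probability zero are
never observed). Nearly maximal losses occur only where both densities are bounded away from zero
(`exists_lower_bound_of_nearly_maximal`, from the condition on maximizing sequences), so the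
empirical maximizer is eventually located there and the rates follow (`IsArgmaxOn.abs_sub_le`). The
same upper bound handles a maximum loss of zero. If the maximum loss is infinite, it is attained
at a point where exactly one density vanishes: there one estimate falls to the floor `τ → 0` and
the other does not, and the empirical loss diverges. `empLoss_argmax_asymptotics` carries out this
part for both kinds of algorithms at once.
-/

namespace LocalDP

/-! ### A Bernstein-type deviation inequality -/

section Chernoff

variable {S : Type*} [MeasurableSpace S] {ν : Measure S} [IsProbabilityMeasure ν]
  {g : S → ℝ} {B v l : ℝ}

lemma integrable_of_abs_le (hg : Measurable g) (hB : ∀ y, |g y| ≤ B) : Integrable g ν :=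
  Integrable.of_bound hg.aestronglyMeasurable B (ae_of_all _ hB)

lemma abs_integral_le_of_abs_le (hB : ∀ y, |g y| ≤ B) : |∫ y, g y ∂ν| ≤ B := by
  have := norm_integral_le_of_norm_le_const (μ := ν) (f := g) (C := B) (ae_of_all _ hB)
  simpa using this

/-- The exponential moment of a centred bounded function is controlled by its second moment,
as long as the exponent stays in `[-1, 1]`, where `exp y ≤ 1 + y + y ^ 2`. -/
lemma integral_exp_centered_le (hg : Measurable g) (hB : ∀ y, |g y| ≤ B)
    (hv : ∫ y, g y ^ 2 ∂ν ≤ v) (hl : 0 ≤ l) (hBl : 2 * B * l ≤ 1) :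
    ∫ y, Real.exp (l * (g y - ∫ z, g z ∂ν)) ∂ν ≤ Real.exp (l ^ 2 * v) := by
  set m := ∫ z, g z ∂ν with hm
  have hgi : Integrable g ν := integrable_of_abs_le hg hB
  have hmB : |m| ≤ B := abs_integral_le_of_abs_le hB
  have hg2i : Integrable (fun y => g y ^ 2) ν := by
    refine integrable_of_abs_le (B := B ^ 2) (hg.pow_const 2) fun y => ?_
    rw [abs_pow]
    exact pow_le_pow_left₀ (abs_nonneg _) (hB y) 2
  have hy : ∀ y, |l * (g y - m)| ≤ 1 := fun y => by
    rw [abs_mul, abs_of_nonneg hl]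
    have : |g y - m| ≤ 2 * B := (abs_sub _ _).trans (by linarith [hB y])
    calc l * |g y - m| ≤ l * (2 * B) := by gcongr
      _ ≤ 1 := by linarith
  have hpt : ∀ y, Real.exp (l * (g y - m)) ≤
      (1 + l * (g y - m)) + (l ^ 2 * g y ^ 2 - 2 * l ^ 2 * m * g y + l ^ 2 * m ^ 2) :=
    fun y => by
      have := (abs_le.1 (Real.abs_exp_sub_one_sub_id_le (hy y))).2
      nlinarith [this]
  have hei : Integrable (fun y => Real.exp (l * (g y - m))) ν := by
    refine integrable_of_abs_le (B := Real.exp 1) (by fun_prop) fun y => ?_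
    rw [abs_of_pos (Real.exp_pos _)]
    exact Real.exp_le_exp.2 ((le_abs_self _).trans (hy y))
  have hi1 : Integrable (fun y => 1 + l * (g y - m)) ν := by fun_prop
  have hi2 : Integrable (fun y => l ^ 2 * g y ^ 2 - 2 * l ^ 2 * m * g y + l ^ 2 * m ^ 2) ν := by
    fun_prop
  calc ∫ y, Real.exp (l * (g y - m)) ∂ν
      ≤ ∫ y, ((1 + l * (g y - m)) +
          (l ^ 2 * g y ^ 2 - 2 * l ^ 2 * m * g y + l ^ 2 * m ^ 2)) ∂ν :=
        integral_mono hei (hi1.add hi2) hpt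
    _ = 1 + l ^ 2 * (∫ y, g y ^ 2 ∂ν) - l ^ 2 * m ^ 2 := by
        rw [integral_add hi1 hi2, integral_add (by fun_prop) (by fun_prop),
          integral_const_mul, integral_sub hgi (by fun_prop), integral_add (by fun_prop)
          (by fun_prop), integral_sub (by fun_prop) (by fun_prop), integral_const_mul,
          integral_const_mul, ← hm]
        simp
        ring
    _ ≤ l ^ 2 * v + 1 := by nlinarith [mul_nonneg (sq_nonneg l) (sq_nonneg m),
        mul_le_mul_of_nonneg_left hv (sq_nonneg l)]
    _ ≤ Real.exp (l ^ 2 * v) := Real.add_one_le_exp _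

variable {Ω : Type*} [MeasurableSpace Ω] {P : Measure Ω} [IsProbabilityMeasure P]
  {n : ℕ} {X : Fin n → Ω → S}

lemma measure_sum_centered_ge_le (hX : ∀ i, Measurable (X i)) (hlaw : ∀ i, P.map (X i) = ν)
    (hind : iIndepFun X P) (hg : Measurable g) (hB : ∀ y, |g y| ≤ B)
    (hv : ∫ y, g y ^ 2 ∂ν ≤ v) (hl : 0 ≤ l) (hBl : 2 * B * l ≤ 1) (s : ℝ) :
    P {ω | s ≤ ∑ i, (g (X i ω) - ∫ y, g y ∂ν)} ≤
      ENNReal.ofReal (Real.exp (-l * s + n * (l ^ 2 * v))) := by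
  set m := ∫ z, g z ∂ν with hm
  let Z : Fin n → Ω → ℝ := fun i ω => g (X i ω) - m
  have hZm : ∀ i, Measurable (Z i) := fun i => (hg.comp (hX i)).sub_const m
  have hZind : iIndepFun Z P := hind.comp (fun _ y => g y - m) fun _ => hg.sub_const m
  have hmgf : ∀ i, mgf (Z i) P l ≤ Real.exp (l ^ 2 * v) := fun i => by
    have := integral_exp_centered_le (ν := ν) hg hB hv hl hBl
    rw [← hlaw i, integral_map (hX i).aemeasurable (by fun_prop), hlaw i] at this
    exact this
  have hsum : (fun ω => ∑ i, (g (X i ω) - m)) = ∑ i, Z i := by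
    ext ω; simp [Z]
  have hint : Integrable (fun ω => Real.exp (l * (∑ i, Z i) ω)) P :=
    hZind.integrable_exp_mul_sum hZm fun i _ => by
      refine integrable_of_abs_le (B := Real.exp (l * (2 * B))) (by fun_prop) fun ω => ?_
      rw [abs_of_pos (Real.exp_pos _)]
      refine Real.exp_le_exp.2 (mul_le_mul_of_nonneg_left ?_ hl)
      have h1 := (abs_le.1 (hB (X i ω))).2
      have h2 := (abs_le.1 (abs_integral_le_of_abs_le (ν := ν) hB)).1
      simp only [Z]
      linarith
  have key := measure_ge_le_exp_mul_mgf (μ := P) (X := ∑ i, Z i) s hl hint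
  rw [hZind.mgf_sum hZm] at key
  have hset : {ω | s ≤ ∑ i, (g (X i ω) - m)} = {ω | s ≤ (∑ i, Z i) ω} := by
    ext ω; simp [Z]
  rw [hset, ← ofReal_measureReal]
  refine ENNReal.ofReal_le_ofReal (key.trans ?_)
  rw [Real.exp_add]
  refine mul_le_mul_of_nonneg_left ?_ (Real.exp_pos _).le
  calc ∏ i, mgf (Z i) P l ≤ ∏ _i : Fin n, Real.exp (l ^ 2 * v) :=
        Finset.prod_le_prod (fun i _ => mgf_nonneg) fun i _ => hmgf i
    _ = Real.exp (n * (l ^ 2 * v)) := by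
        rw [Finset.prod_const, Finset.card_univ, Fintype.card_fin, ← Real.exp_nat_mul]

/-- A Bernstein-type inequality: for a function `g` bounded by `B`, the sum of `g` over an
i.i.d. sample of size `n` deviates from its expectation by `s` or more with probability at most
`2 exp (-l s + n l² E[g²])`, for every admissible parameter `l ≤ 1 / (2B)`. -/
lemma measure_abs_sum_sub_ge_le (hX : ∀ i, Measurable (X i)) (hlaw : ∀ i, P.map (X i) = ν)
    (hind : iIndepFun X P) (hg : Measurable g) (hB : ∀ y, |g y| ≤ B)
    (hv : ∫ y, g y ^ 2 ∂ν ≤ v) (hl : 0 ≤ l) (hBl : 2 * B * l ≤ 1) (s : ℝ) :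
    P {ω | s ≤ |∑ i, g (X i ω) - n * ∫ y, g y ∂ν|} ≤
      2 * ENNReal.ofReal (Real.exp (-l * s + n * (l ^ 2 * v))) := by
  have h1 := measure_sum_centered_ge_le hX hlaw hind hg hB hv hl hBl s
  have h2 := measure_sum_centered_ge_le (g := fun y => -g y) hX hlaw hind hg.neg
    (by simpa using hB) (by simpa using hv) hl hBl s
  rw [two_mul]
  refine (measure_mono ?_).trans ((measure_union_le _ _).trans (add_le_add h1 h2))
  intro ω hω
  simp only [Set.mem_ofPred_eq, Set.mem_union, integral_neg, Finset.sum_sub_distrib,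
    Finset.sum_neg_distrib, Finset.sum_const, Finset.card_univ, Fintype.card_fin,
    nsmul_eq_mul] at hω ⊢
  rcases le_abs.1 hω with h | h
  · left; linarith
  · right; linarith

end Chernoff

/-! ### Kernels -/

section Kernel

variable {d : ℕ} {K : E d → ℝ}

lemma IsKernel.le_of_norm_le (hK : IsKernel K) {u v : E d} (h : ‖u‖ ≤ ‖v‖) : K v ≤ K u := by
  obtain ⟨k, hk, -, hKk, -⟩ := hK.radial_tails
  rw [hKk, hKk]
  exact hk (norm_nonneg u) (norm_nonneg v) h

lemma IsKernel.le_zero (hK : IsKernel K) (u : E d) : K u ≤ K 0 :=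
  hK.le_of_norm_le (by simp)

lemma IsKernel.integrable (hK : IsKernel K) : Integrable K := by
  by_contra h
  have := hK.integral_eq_one
  rw [integral_undef h] at this
  exact zero_ne_one this

/-- The exponential tails make all moments of a kernel finite. -/
lemma IsKernel.integrable_norm_rpow_mul (hK : IsKernel K) {b : ℝ} (hb : 0 ≤ b) :
    Integrable (fun u => ‖u‖ ^ b * K u) := by
  obtain ⟨k, -, hk0, hKk, ρ, c, t₀, hρ, hc, -, hkt⟩ := hK.radial_tails
  have hcont : Continuous (fun u : E d => ‖u‖ ^ b * K u) :=
    (continuous_norm.rpow_const fun _ => Or.inr hb).mul hK.continuous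
  have hdecay : ∀ᶠ t : ℝ in atTop, t ^ b * k t ≤ c * t ^ (-((d : ℝ) + 1)) := by
    have h1 := (tendsto_rpow_mul_exp_neg_mul_atTop_nhds_zero ((b + (d + 1)) / ρ) 1
      one_pos).comp (tendsto_rpow_atTop hρ)
    filter_upwards [h1.eventually_le_const one_pos, eventually_gt_atTop t₀,
      eventually_gt_atTop 0] with t ht1 ht2 ht3
    have e1 : (t ^ ρ) ^ ((b + (d + 1)) / ρ) = t ^ b * t ^ ((d : ℝ) + 1) := by
      rw [← Real.rpow_mul ht3.le, mul_div_cancel₀ _ hρ.ne', Real.rpow_add ht3]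
    simp only [Function.comp, e1, neg_mul, one_mul] at ht1
    have hp : 0 < t ^ ((d : ℝ) + 1) := Real.rpow_pos_of_pos ht3 _
    rw [Real.rpow_neg ht3.le, ← div_eq_mul_inv, le_div_iff₀ hp]
    calc t ^ b * k t * t ^ ((d : ℝ) + 1)
        ≤ t ^ b * (c * Real.exp (-t ^ ρ)) * t ^ ((d : ℝ) + 1) := by
          have := hkt t ht2
          gcongr
      _ = c * (t ^ b * t ^ ((d : ℝ) + 1) * Real.exp (-t ^ ρ)) := by ring
      _ ≤ c * 1 := by gcongr
      _ = c := mul_one c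
  refine hcont.locallyIntegrable.integrable_of_isBigO_cocompact
    (g := fun u : E d => (1 + ‖u‖) ^ (-((d : ℝ) + 1))) ?_
    ((integrable_one_add_norm (by simp)).integrableAtFilter _)
  refine IsBigO.of_bound (c * 2 ^ ((d : ℝ) + 1)) ?_
  have hn := tendsto_norm_cocompact_atTop (E := E d)
  filter_upwards [hn.eventually hdecay, hn.eventually (eventually_ge_atTop 1)] with u hu hu1
  rw [← hKk] at hu
  have hu0 : 0 < ‖u‖ := by linarith
  rw [Real.norm_of_nonneg (mul_nonneg (by positivity) (hK.nonneg u)),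
    Real.norm_of_nonneg (by positivity)]
  refine hu.trans ?_
  rw [mul_assoc]
  gcongr
  rw [Real.rpow_neg hu0.le, Real.rpow_neg (by positivity), ← div_eq_mul_inv,
    le_div_iff₀ (by positivity), inv_mul_le_iff₀ (by positivity),
    ← Real.mul_rpow hu0.le (by norm_num)]
  gcongr
  linarith

end Kernel

/-! ### Kernel smoothing of a Hölder continuous density -/

section Smoothing

variable {d : ℕ} {K f : E d → ℝ} {β L : ℝ}

/-- The measure with Lebesgue density `f`. -/
noncomputable abbrev densityMeasure (f : E d → ℝ) : Measure (E d) :=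
  (volume : Measure (E d)).withDensity fun t => ENNReal.ofReal (f t)

lemma integral_densityMeasure (hf : Continuous f) (hf0 : ∀ t, 0 ≤ f t) (g : E d → ℝ) :
    ∫ y, g y ∂densityMeasure f = ∫ y, f y * g y := by
  rw [integral_withDensity_eq_integral_toReal_smul (by fun_prop) (by simp)]
  simp [ENNReal.toReal_ofReal, hf0]

lemma integral_kernel_scaled (hf : Continuous f) (hf0 : ∀ t, 0 ≤ f t) {h : ℝ} (hh : 0 < h)
    (s : E d) :
    ∫ y, K (h⁻¹ • (s - y)) ∂densityMeasure f = h ^ d * ∫ w, f (s - h • w) * K w := by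
  rw [integral_densityMeasure hf hf0]
  have h1 := integral_sub_left_eq_self (fun z => f (s - z) * K (h⁻¹ • z)) volume s
  have h2 := Measure.integral_comp_inv_smul (volume : Measure (E d))
    (fun w => f (s - h • w) * K w) h
  simp only [sub_sub_cancel] at h1
  rw [h1, ← abs_of_pos (pow_pos hh d)]
  simpa [smul_smul, hh.ne'] using h2

/-- The bias of kernel smoothing with bandwidth `h` is of order `h ^ β`. -/
lemma abs_integral_kernel_scaled_sub_le (hK : IsKernel K) (hf : Continuous f)
    (hf0 : ∀ t, 0 ≤ f t) (hβ : 0 ≤ β) (hL : ∀ y z, |f y - f z| ≤ L * ‖y - z‖ ^ β)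
    {h : ℝ} (hh : 0 < h) (s : E d) :
    |∫ y, K (h⁻¹ • (s - y)) ∂densityMeasure f - h ^ d * f s| ≤
      h ^ d * (L * h ^ β * ∫ u, ‖u‖ ^ β * K u) := by
  rw [integral_kernel_scaled hf hf0 hh, ← mul_sub, abs_mul, abs_of_pos (pow_pos hh d)]
  refine mul_le_mul_of_nonneg_left ?_ (pow_pos hh d).le
  have hKi := hK.integrable
  have hKb := hK.integrable_norm_rpow_mul hβ
  have hpt : ∀ w, ‖f (s - h • w) * K w - f s * K w‖ ≤ L * h ^ β * (‖w‖ ^ β * K w) := by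
    intro w
    rw [← sub_mul, norm_mul, Real.norm_eq_abs, Real.norm_of_nonneg (hK.nonneg w)]
    have h1 := hL (s - h • w) s
    rw [sub_sub_cancel_left, norm_neg, norm_smul, Real.norm_of_nonneg hh.le,
      Real.mul_rpow hh.le (norm_nonneg w)] at h1
    calc _ ≤ L * (h ^ β * ‖w‖ ^ β) * K w := mul_le_mul_of_nonneg_right h1 (hK.nonneg w)
      _ = _ := by ring
  have hdi : Integrable (fun w => f (s - h • w) * K w - f s * K w) := by
    refine (hKb.const_mul (L * h ^ β)).mono' ?_ (ae_of_all _ hpt)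
    have := hK.continuous
    exact Continuous.aestronglyMeasurable (by fun_prop)
  have hi : Integrable (fun w => f (s - h • w) * K w) := by
    refine (hdi.add (hKi.const_mul (f s))).congr (ae_of_all _ fun w => ?_)
    simp
  have e : f s = ∫ w, f s * K w := by rw [integral_const_mul, hK.integral_eq_one, mul_one]
  conv_lhs => rw [e]
  rw [← integral_sub hi (hKi.const_mul _), ← integral_const_mul, ← Real.norm_eq_abs]
  exact norm_integral_le_of_norm_le (hKb.const_mul _) (ae_of_all _ hpt)

lemma densityMeasure_real_ball_le (hf0 : ∀ t, 0 ≤ f t)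
    (hβ : 0 ≤ β) (hL0 : 0 ≤ L) (hL : ∀ y z, |f y - f z| ≤ L * ‖y - z‖ ^ β)
    {r : ℝ} (hr : 0 < r) (s : E d) :
    (densityMeasure f).real (Metric.ball s r) ≤
      (f s + L * r ^ β) * (r ^ d * (volume : Measure (E d)).real (Metric.ball 0 1)) := by
  have hb : 0 ≤ f s + L * r ^ β := add_nonneg (hf0 s) (by positivity)
  have hvol : (volume : Measure (E d)) (Metric.ball s r) =
      ENNReal.ofReal (r ^ d * (volume : Measure (E d)).real (Metric.ball 0 1)) := by
    rw [Measure.addHaar_ball_of_pos _ _ hr, ENNReal.ofReal_mul (by positivity),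
      ofReal_measureReal measure_ball_lt_top.ne]
    simp
  refine ENNReal.toReal_le_of_le_ofReal (by positivity) ?_
  rw [withDensity_apply _ measurableSet_ball, ENNReal.ofReal_mul hb, ← hvol]
  rw [← setLIntegral_const]
  refine setLIntegral_mono measurable_const fun y hy => ENNReal.ofReal_le_ofReal ?_
  have h1 := (abs_le.1 (hL y s)).2
  have h2 : ‖y - s‖ ^ β ≤ r ^ β := by
    gcongr
    exact (mem_ball_iff_norm.1 hy).le
  nlinarith [mul_le_mul_of_nonneg_left h2 hL0]

end Smoothing

/-! ### Brackets for translated kernels -/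

section Bracket

variable {d : ℕ} {K f : E d → ℝ}

/-- The function `y ↦ K (c (s - y) / h) + σ K(0) 1{|y - s| < δ h}`. For `c = 1 - δ`, `σ = 1` it
is an upper bound, and for `c = 1 + δ`, `σ = -1` a lower bound, of `y ↦ K ((t - y) / h)`,
simultaneously for all `t` with `|t - s| ≤ δ² h`. -/
noncomputable def bracket (K : E d → ℝ) (h δ c σ : ℝ) (s y : E d) : ℝ :=
  K ((h / c)⁻¹ • (s - y)) + σ * K 0 * (Metric.ball s (δ * h)).indicator 1 y

lemma measurable_bracket (hK : IsKernel K) (h δ c σ : ℝ) (s : E d) :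
    Measurable (bracket K h δ c σ s) := by
  have := hK.continuous.measurable
  unfold bracket
  refine Measurable.add (by fun_prop) (Measurable.const_mul ?_ _)
  exact measurable_one.indicator measurableSet_ball

lemma abs_bracket_le_add (hK : IsKernel K) {h δ c σ : ℝ} (hσ : |σ| ≤ 1) (s y : E d) :
    |bracket K h δ c σ s y| ≤
      K ((h / c)⁻¹ • (s - y)) + K 0 * (Metric.ball s (δ * h)).indicator 1 y := by
  have h0 := hK.nonneg 0
  have h1 := hK.nonneg ((h / c)⁻¹ • (s - y))
  have h2 : 0 ≤ (Metric.ball s (δ * h)).indicator (1 : E d → ℝ) y :=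
    Set.indicator_nonneg (by simp) y
  refine (abs_add_le _ _).trans ?_
  rw [abs_of_nonneg h1, abs_mul, abs_mul, abs_of_nonneg h0, abs_of_nonneg h2]
  gcongr
  exact mul_le_of_le_one_left h0 hσ

lemma abs_bracket_le (hK : IsKernel K) {h δ c σ : ℝ} (hσ : |σ| ≤ 1) (s y : E d) :
    |bracket K h δ c σ s y| ≤ 2 * K 0 := by
  refine (abs_bracket_le_add hK hσ s y).trans ?_
  have h1 : (Metric.ball s (δ * h)).indicator (1 : E d → ℝ) y ≤ 1 :=
    Set.indicator_le_self' (by simp) y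
  have := hK.le_zero ((h / c)⁻¹ • (s - y))
  nlinarith [mul_le_mul_of_nonneg_left h1 (hK.nonneg 0)]

/-- Outside the ball of radius `δ h` around `s`, moving `s` by `δ² h` changes the distance to `y`
by a factor between `1 - δ` and `1 + δ`, and the kernel is monotone in the distance. Inside the
ball the kernel is compared with `0` and `K 0`. -/
lemma bracket_le_le_bracket (hK : IsKernel K) {h δ : ℝ} (hh : 0 < h) (hδ : 0 < δ) (hδ1 : δ < 1)
    {s t : E d} (hts : ‖t - s‖ ≤ δ ^ 2 * h) (y : E d) :
    bracket K h δ (1 + δ) (-1) s y ≤ K (h⁻¹ • (t - y)) ∧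
      K (h⁻¹ • (t - y)) ≤ bracket K h δ (1 - δ) 1 s y := by
  unfold bracket
  by_cases hy : y ∈ Metric.ball s (δ * h)
  · simp only [Set.indicator_of_mem hy, Pi.one_apply]
    have h1 := hK.le_zero ((h / (1 + δ))⁻¹ • (s - y))
    have h2 := hK.nonneg ((h / (1 - δ))⁻¹ • (s - y))
    have h3 := hK.le_zero (h⁻¹ • (t - y))
    have h4 := hK.nonneg (h⁻¹ • (t - y))
    constructor <;> linarith
  · simp only [Set.indicator_of_notMem hy, mul_zero, add_zero]
    have hsy : δ * h ≤ ‖s - y‖ := by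
      rw [norm_sub_rev]
      simpa only [mem_ball_iff_norm, not_lt] using hy
    have hmv : ‖t - s‖ ≤ δ * ‖s - y‖ := hts.trans (by nlinarith)
    have e : t - y = (t - s) + (s - y) := by abel
    have hup : ‖t - y‖ ≤ (1 + δ) * ‖s - y‖ := by
      rw [e]
      linarith [norm_add_le (t - s) (s - y)]
    have hlo : (1 - δ) * ‖s - y‖ ≤ ‖t - y‖ := by
      have := norm_sub_le (t - y) (t - s)
      rw [sub_sub_sub_cancel_left] at this
      linarith
    have n1 : ∀ (a : ℝ) (u : E d), 0 < a → ‖a • u‖ = a * ‖u‖ := fun a u ha => by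
      rw [norm_smul, Real.norm_of_nonneg ha.le]
    have hd1 : 0 < 1 - δ := by linarith
    constructor <;> apply hK.le_of_norm_le
    · rw [n1 _ _ (by positivity), n1 _ _ (by positivity), inv_div, inv_mul_eq_div,
        div_mul_eq_mul_div]
      gcongr
    · rw [n1 _ _ (by positivity), n1 _ _ (by positivity), inv_div, inv_mul_eq_div,
        div_mul_eq_mul_div]
      gcongr

end Bracket

section BracketMoments

variable {d : ℕ} {K f : E d → ℝ} {β L : ℝ}

/-- For `c` within `δ` of `1`, the expectation of a bracket differs from `h ^ d * f s` by
`O (h ^ d (δ + h ^ β))`, and its second moment is `O (h ^ d)`, with constants depending on `s`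
through an upper bound for `f s` only. -/
lemma exists_bracket_moments_le (hd : d ≠ 0) (hK : IsKernel K) (hf : Continuous f)
    (hf0 : ∀ t, 0 ≤ f t) [IsProbabilityMeasure (densityMeasure f)] (hβ : 0 ≤ β) (hβ1 : β ≤ 1)
    (hL0 : 0 ≤ L) (hL : ∀ y z, |f y - f z| ≤ L * ‖y - z‖ ^ β) {F : ℝ} (hF : 0 ≤ F) :
    ∃ A B : ℝ, 0 ≤ A ∧ 0 ≤ B ∧ ∀ (s : E d) (h δ c σ : ℝ), f s ≤ F → 0 < h → h ≤ 1 → 0 < δ →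
      δ ≤ 1 / 2 → |c - 1| ≤ δ → |σ| ≤ 1 →
      |∫ y, bracket K h δ c σ s y ∂densityMeasure f - h ^ d * f s| ≤
          h ^ d * (A * (δ + h ^ β)) ∧
        ∫ y, bracket K h δ c σ s y ^ 2 ∂densityMeasure f ≤ B * h ^ d := by
  set ν := densityMeasure f
  set κ := ∫ u, ‖u‖ ^ β * K u with hκ
  set V := (volume : Measure (E d)).real (Metric.ball 0 1)
  have hκ0 : 0 ≤ κ := integral_nonneg fun u => mul_nonneg (by positivity) (hK.nonneg u)
  have hV0 : 0 ≤ V := measureReal_nonneg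
  have hK0 := hK.nonneg 0
  refine ⟨2 ^ d * (2 * L * κ) + F * (2 ^ d * (d * 2 ^ d)) + K 0 * ((F + L) * V),
    2 * K 0 * (2 ^ d * (F + 2 * L * κ) + K 0 * ((F + L) * V)), by positivity, by positivity, ?_⟩
  intro s h δ c σ hs hh hh1 hδ hδ1 hc hσ
  have hc1 : 1 / 2 ≤ c := by linarith [(abs_le.1 hc).1]
  have hc2 : c ≤ 2 := by linarith [(abs_le.1 hc).2]
  have hc0 : 0 < c := by linarith
  have hfs := hf0 s
  have hhb : h ^ β ≤ 1 := Real.rpow_le_one hh.le hh1 hβ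
  have hhb0 : 0 ≤ h ^ β := by positivity
  have hd0 : 0 < h ^ d := pow_pos hh d
  have hq : 0 < h / c := by positivity
  have hq2 : h / c ≤ 2 * h := by
    rw [div_le_iff₀ hc0]
    nlinarith
  have hqb : (h / c) ^ β ≤ 2 * h ^ β := by
    calc (h / c) ^ β ≤ (2 * h) ^ β := by gcongr
      _ = 2 ^ β * h ^ β := Real.mul_rpow (by norm_num) hh.le
      _ ≤ 2 ^ (1 : ℝ) * h ^ β := by gcongr; norm_num
      _ = 2 * h ^ β := by rw [Real.rpow_one]
  have hqd : (h / c) ^ d ≤ 2 ^ d * h ^ d := by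
    rw [← mul_pow]
    gcongr
  -- the part of the bracket coming from the dilated kernel
  set I := ∫ y, K ((h / c)⁻¹ • (s - y)) ∂ν with hI
  have hI1 : |I - (h / c) ^ d * f s| ≤ h ^ d * (2 ^ d * (2 * L * κ) * h ^ β) := by
    refine (abs_integral_kernel_scaled_sub_le hK hf hf0 hβ hL hq s).trans ?_
    rw [← hκ]
    calc (h / c) ^ d * (L * (h / c) ^ β * κ)
        ≤ (2 ^ d * h ^ d) * (L * (2 * h ^ β) * κ) := by gcongr
      _ = _ := by ring
  have hcd : |(h / c) ^ d - h ^ d| ≤ h ^ d * (2 ^ d * (d * 2 ^ d) * δ) := by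
    have e : (h / c) ^ d - h ^ d = (h / c) ^ d * (1 ^ d - c ^ d) := by
      rw [mul_sub, div_pow, div_mul_cancel₀ _ (by positivity)]
      simp
    have h1 : |(1 : ℝ) ^ d - c ^ d| ≤ δ * d * 2 ^ d := by
      refine (abs_pow_sub_pow_le 1 c d).trans ?_
      rw [abs_sub_comm, abs_one, abs_of_pos hc0]
      have : max 1 c ^ (d - 1) ≤ (2 : ℝ) ^ d :=
        (pow_le_pow_left₀ (by positivity) (max_le (by norm_num) hc2) _).trans
          (pow_le_pow_right₀ (by norm_num) (Nat.sub_le _ _))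
      gcongr
    rw [e, abs_mul, abs_of_pos (pow_pos hq d)]
    calc _ ≤ (2 ^ d * h ^ d) * (δ * d * 2 ^ d) := by gcongr
      _ = _ := by ring
  have hI2 : |I - h ^ d * f s| ≤
      h ^ d * (2 ^ d * (2 * L * κ) * h ^ β + F * (2 ^ d * (d * 2 ^ d)) * δ) := by
    have e : I - h ^ d * f s = (I - (h / c) ^ d * f s) + ((h / c) ^ d - h ^ d) * f s := by ring
    rw [e]
    refine (abs_add_le _ _).trans ?_
    rw [abs_mul, abs_of_nonneg hfs, mul_add]
    refine add_le_add hI1 ?_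
    calc _ ≤ h ^ d * (2 ^ d * (d * 2 ^ d) * δ) * F := by gcongr
      _ = _ := by ring
  have hI3 : I ≤ 2 ^ d * (F + 2 * L * κ) * h ^ d := by
    have h1 := (abs_le.1 hI1).2
    have h2 : (h / c) ^ d * f s ≤ 2 ^ d * h ^ d * F := by gcongr
    have h3 : h ^ d * (2 ^ d * (2 * L * κ) * h ^ β) ≤ h ^ d * (2 ^ d * (2 * L * κ) * 1) := by
      gcongr
    linarith
  -- the part of the bracket coming from the small ball
  set b := ν.real (Metric.ball s (δ * h)) with hb
  have hb0 : 0 ≤ b := measureReal_nonneg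
  have hb1 : b ≤ (F + L) * V * (h ^ d * δ) := by
    refine (densityMeasure_real_ball_le hf0 hβ hL0 hL (mul_pos hδ hh) s).trans ?_
    have h1 : (δ * h) ^ β ≤ 1 := Real.rpow_le_one (by positivity) (by nlinarith) hβ
    have h2 : (δ * h) ^ d ≤ h ^ d * δ := by
      rw [mul_pow, mul_comm]
      have : δ ^ d ≤ δ := pow_le_of_le_one hδ.le (by linarith) hd
      gcongr
    calc (f s + L * (δ * h) ^ β) * ((δ * h) ^ d * V) ≤ (F + L * 1) * ((h ^ d * δ) * V) := by
          gcongr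
      _ = _ := by ring
  have hKi : Integrable (fun y => K ((h / c)⁻¹ • (s - y))) ν := by
    have := hK.continuous.measurable
    refine integrable_of_abs_le (B := K 0) (by fun_prop) fun y => ?_
    rw [abs_of_nonneg (hK.nonneg _)]
    exact hK.le_zero _
  have hBi : Integrable (fun y => (Metric.ball s (δ * h)).indicator (1 : E d → ℝ) y) ν :=
    (integrable_const (1 : ℝ)).indicator measurableSet_ball
  have hBint : ∫ y, (Metric.ball s (δ * h)).indicator (1 : E d → ℝ) y ∂ν = b :=
    integral_indicator_one measurableSet_ball
  have hW : ∫ y, bracket K h δ c σ s y ∂ν = I + σ * K 0 * b := by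
    unfold bracket
    rw [integral_add hKi (hBi.const_mul _), integral_const_mul, hBint]
  constructor
  · have e : I + σ * K 0 * b - h ^ d * f s = (I - h ^ d * f s) + σ * (K 0 * b) := by ring
    rw [hW, e]
    have h1 : |σ * (K 0 * b)| ≤ K 0 * ((F + L) * V * (h ^ d * δ)) := by
      rw [abs_mul, abs_of_nonneg (mul_nonneg hK0 hb0)]
      exact (mul_le_of_le_one_left (by positivity) hσ).trans (by gcongr)
    refine ((abs_add_le _ _).trans (add_le_add hI2 h1)).trans ?_
    have p1 : 0 ≤ 2 ^ d * (2 * L * κ) * δ := by positivity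
    have p2 : 0 ≤ F * (2 ^ d * (d * 2 ^ d)) * h ^ β := by positivity
    have p3 : 0 ≤ K 0 * ((F + L) * V) * h ^ β := by positivity
    have := mul_nonneg hd0.le (add_nonneg (add_nonneg p1 p2) p3)
    linarith
  · have hpt : ∀ y, bracket K h δ c σ s y ^ 2 ≤ 2 * K 0 *
        (K ((h / c)⁻¹ • (s - y)) + K 0 * (Metric.ball s (δ * h)).indicator 1 y) := fun y => by
      rw [← sq_abs, sq]
      exact mul_le_mul (abs_bracket_le hK hσ s y) (abs_bracket_le_add hK hσ s y)
        (abs_nonneg _) (by positivity)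
    have hi2 : Integrable (fun y => bracket K h δ c σ s y ^ 2) ν := by
      refine integrable_of_abs_le (B := (2 * K 0) ^ 2)
        ((measurable_bracket hK h δ c σ s).pow_const 2) fun y => ?_
      rw [abs_pow]
      exact pow_le_pow_left₀ (abs_nonneg _) (abs_bracket_le hK hσ s y) 2
    calc ∫ y, bracket K h δ c σ s y ^ 2 ∂ν
        ≤ ∫ y, 2 * K 0 *
          (K ((h / c)⁻¹ • (s - y)) + K 0 * (Metric.ball s (δ * h)).indicator 1 y) ∂ν :=
          integral_mono hi2 ((hKi.add (hBi.const_mul _)).const_mul _) hpt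
      _ = 2 * K 0 * (I + K 0 * b) := by
          rw [integral_const_mul, integral_add hKi (hBi.const_mul _), integral_const_mul, hBint]
      _ ≤ 2 * K 0 * (2 ^ d * (F + 2 * L * κ) * h ^ d + K 0 * ((F + L) * V * (h ^ d * 1))) := by
          gcongr
          refine hb1.trans ?_
          gcongr
          linarith
      _ = _ := by ring

end BracketMoments

/-! ### Uniform precision of the kernel density estimator -/

section Uniform

variable {d : ℕ} {K f : E d → ℝ} {β L : ℝ} {Ω : Type*} [MeasurableSpace Ω] {P : Measure Ω}
  [IsProbabilityMeasure P]

lemma abs_kde_sub_le_of_bracket (hK : IsKernel K) {n : ℕ} (hn : n ≠ 0) (X : Fin n → E d)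
    {h δ r a F : ℝ} {mu mo : ℝ} (hh : 0 < h) (hδ : 0 < δ) (hδ1 : δ < 1) {s t : E d}
    (hts : ‖t - s‖ ≤ δ ^ 2 * h)
    (hmu : |mu - h ^ d * F| ≤ h ^ d * a) (hmo : |mo - h ^ d * F| ≤ h ^ d * a)
    (hu : |∑ i, bracket K h δ (1 + δ) (-1) s (X i) - n * mu| < n * h ^ d * r)
    (ho : |∑ i, bracket K h δ (1 - δ) 1 s (X i) - n * mo| < n * h ^ d * r) :
    |kde K X h t - F| ≤ r + a := by
  have hn0 : (0 : ℝ) < n := by positivity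
  have hd0 : 0 < h ^ d := pow_pos hh d
  have h1 : ∑ i, bracket K h δ (1 + δ) (-1) s (X i) ≤ ∑ i, K (h⁻¹ • (t - X i)) :=
    Finset.sum_le_sum fun i _ => (bracket_le_le_bracket hK hh hδ hδ1 hts (X i)).1
  have h2 : ∑ i, K (h⁻¹ • (t - X i)) ≤ ∑ i, bracket K h δ (1 - δ) 1 s (X i) :=
    Finset.sum_le_sum fun i _ => (bracket_le_le_bracket hK hh hδ hδ1 hts (X i)).2
  have e : kde K X h t - F =
      (∑ i, K (h⁻¹ • (t - X i)) - n * h ^ d * F) / (n * h ^ d) := by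
    unfold kde
    field_simp
  rw [e, abs_div, abs_of_pos (a := n * h ^ d) (by positivity), div_le_iff₀ (by positivity),
    abs_le]
  have b1 := mul_le_mul_of_nonneg_left (abs_le.1 hmu).1 hn0.le
  have b2 := mul_le_mul_of_nonneg_left (abs_le.1 hmo).2 hn0.le
  have c1 := (abs_lt.1 hu).1
  have c2 := (abs_lt.1 ho).2
  constructor <;> linarith

/-- Around each point `s`, the kernel density estimator is precise, uniformly over the ball of
radius `δ² h`, with exponentially high probability. -/
lemma exists_measure_local_deviation_le (hd : d ≠ 0) (hK : IsKernel K) (hf : Continuous f)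
    (hf0 : ∀ t, 0 ≤ f t) [IsProbabilityMeasure (densityMeasure f)] (hβ : 0 ≤ β) (hβ1 : β ≤ 1)
    (hL0 : 0 ≤ L) (hL : ∀ y z, |f y - f z| ≤ L * ‖y - z‖ ^ β) {F : ℝ} (hF : 0 ≤ F) :
    ∃ A B : ℝ, 0 ≤ A ∧ 0 ≤ B ∧ ∀ (n : ℕ) (X : Fin n → Ω → E d) (s : E d) (h δ l r : ℝ), n ≠ 0 →
      (∀ i, Measurable (X i)) → (∀ i, P.map (X i) = densityMeasure f) → iIndepFun X P →
      f s ≤ F → 0 < h → h ≤ 1 → 0 < δ → δ ≤ 1 / 2 → 0 ≤ l → 4 * K 0 * l ≤ 1 →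
      P {ω | ∃ t, ‖t - s‖ ≤ δ ^ 2 * h ∧
          r + A * (δ + h ^ β) < |kde K (fun i => X i ω) h t - f t|} ≤
        4 * ENNReal.ofReal (Real.exp (-(l * (r - B * l) * (n * h ^ d)))) := by
  obtain ⟨A, B, hA, hB, hAB⟩ := exists_bracket_moments_le hd hK hf hf0 hβ hβ1 hL0 hL hF
  refine ⟨A + L, B, by positivity, hB, ?_⟩
  intro n X s h δ l r hn hX hlaw hind hs hh hh1 hδ hδ1 hl hKl
  have hδc : |(1 + δ) - 1| ≤ δ := by simp [abs_of_pos hδ]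
  have hδc' : |(1 - δ) - 1| ≤ δ := by simp [abs_of_pos hδ]
  obtain ⟨u1, u2⟩ := hAB s h δ (1 + δ) (-1) hs hh hh1 hδ hδ1 hδc (by simp)
  obtain ⟨o1, o2⟩ := hAB s h δ (1 - δ) 1 hs hh hh1 hδ hδ1 hδc' (by simp)
  have hKl' : 2 * (2 * K 0) * l ≤ 1 := by linarith
  have pu := measure_abs_sum_sub_ge_le hX hlaw hind (measurable_bracket hK h δ (1 + δ) (-1) s)
    (abs_bracket_le hK (by simp) s) u2 hl hKl' (n * h ^ d * r)
  have po := measure_abs_sum_sub_ge_le hX hlaw hind (measurable_bracket hK h δ (1 - δ) 1 s)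
    (abs_bracket_le hK (by simp) s) o2 hl hKl' (n * h ^ d * r)
  have e4 : ∀ a : ℝ≥0∞, 4 * a = 2 * a + 2 * a := fun a => by
    rw [← add_mul]
    norm_num
  have ex : -l * (n * h ^ d * r) + n * (l ^ 2 * (B * h ^ d)) =
      -(l * (r - B * l) * (n * h ^ d)) := by ring
  rw [ex] at pu po
  rw [e4]
  refine (measure_mono ?_).trans ((measure_union_le _ _).trans (add_le_add pu po))
  rintro ω ⟨t, ht, hlt⟩
  by_contra hcon
  simp only [Set.mem_union, Set.mem_ofPred_eq, not_or, not_le] at hcon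
  have k1 := abs_kde_sub_le_of_bracket hK hn (fun i => X i ω) hh hδ (by linarith) ht u1 o1
    hcon.1 hcon.2
  have k2 : |f s - f t| ≤ L * h ^ β := by
    rw [abs_sub_comm]
    refine (hL t s).trans ?_
    have : ‖t - s‖ ≤ h := ht.trans (mul_le_of_le_one_left hh.le (by nlinarith))
    gcongr
  have k3 := abs_sub_le (kde K (fun i => X i ω) h t) (f s) (f t)
  have k4 : 0 ≤ L * δ := by positivity
  linarith

/-- A grid with mesh `1 / p` is a net of a ball. -/
lemma exists_grid_net (d : ℕ) {R : ℝ} {p q : ℕ} (hp : p ≠ 0) (hq : R * p + 1 ≤ q) :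
    ∃ N : Finset (E d), N.card ≤ (2 * q + 1) ^ d ∧
      ∀ t : E d, ‖t‖ ≤ R → ∃ s ∈ N, ‖t - s‖ ≤ d / p := by
  classical
  have hp0 : (0 : ℝ) < p := by positivity
  refine ⟨(Fintype.piFinset fun _ : Fin d => Finset.Icc (-(q : ℤ)) q).image
    fun z => WithLp.toLp 2 fun i => (z i : ℝ) / p, ?_, fun t ht => ?_⟩
  · refine Finset.card_image_le.trans ?_
    rw [Fintype.card_piFinset_const, Int.card_Icc]
    apply le_of_eq
    congr 1
    omega
  · refine ⟨WithLp.toLp 2 fun i => (round (t i * p) : ℝ) / p, Finset.mem_image.2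
      ⟨fun i => round (t i * p), ?_, rfl⟩, ?_⟩
    · rw [Fintype.mem_piFinset]
      intro i
      have h1 : |t i| ≤ R := (PiLp.norm_apply_le t i).trans ht
      have h2 : |t i * p| ≤ R * p := by
        rw [abs_mul, abs_of_pos hp0]
        gcongr
      have h3 := abs_le.1 (abs_sub_round (t i * p))
      have h4 := abs_le.1 h2
      rw [Finset.mem_Icc]
      constructor
      · have : -(q : ℝ) ≤ round (t i * p) := by linarith
        exact_mod_cast this
      · have : (round (t i * p) : ℝ) ≤ q := by linarith
        exact_mod_cast this
    · rw [EuclideanSpace.norm_eq]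
      have hi : ∀ i, ‖(t - WithLp.toLp 2 fun i => (round (t i * p) : ℝ) / p) i‖ ≤ 1 / p := by
        intro i
        have e : (t - WithLp.toLp 2 fun i => (round (t i * p) : ℝ) / p) i =
            (t i * p - round (t i * p)) / p := by
          simp only [PiLp.sub_apply]
          field_simp
        rw [e, norm_div, Real.norm_eq_abs, Real.norm_of_nonneg hp0.le]
        gcongr
        linarith [abs_sub_round (t i * p)]
      refine Real.sqrt_le_iff.2 ⟨by positivity, ?_⟩
      calc ∑ i, ‖(t - WithLp.toLp 2 fun i => (round (t i * p) : ℝ) / p) i‖ ^ 2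
          ≤ ∑ _i : Fin d, (1 / (p : ℝ)) ^ 2 := by
            gcongr with i _
            exact hi i
        _ = d * (1 / (p : ℝ)) ^ 2 := by simp
        _ ≤ (d : ℝ) ^ 2 * (1 / (p : ℝ)) ^ 2 := by
            gcongr
            exact_mod_cast Nat.le_self_pow two_ne_zero d
        _ = (d / (p : ℝ)) ^ 2 := by ring

end Uniform

section Uniform

variable {d : ℕ} {K f : E d → ℝ} {β L : ℝ≥0} {Ω : Type*} [MeasurableSpace Ω] {P : Measure Ω}
  [IsProbabilityMeasure P]

lemma two_mul_add_pos (d : ℕ) (hβ : 0 < β) : 0 < 2 * (β : ℝ) + d := by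
  have : 0 < (β : ℝ) := hβ
  positivity

lemma tendsto_log_mul_rpow_neg {a : ℝ} (ha : 0 < a) :
    Tendsto (fun n : ℕ => Real.log n * (n : ℝ) ^ (-a)) atTop (𝓝 0) := by
  have h := (isLittleO_log_rpow_atTop ha).tendsto_div_nhds_zero.comp
    tendsto_natCast_atTop_atTop
  refine h.congr fun n => ?_
  simp [Real.rpow_neg, div_eq_mul_inv]

lemma contRate_sq (d : ℕ) (β : ℝ≥0) (n : ℕ) :
    contRate d β n ^ 2 = Real.log n * (n : ℝ) ^ (-(2 * ((β : ℝ) / (2 * β + d)))) := by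
  rw [contRate, mul_pow, Real.sq_sqrt (Real.log_natCast_nonneg n), ← Real.rpow_natCast,
    ← Real.rpow_mul (by positivity)]
  congr 2
  push_cast
  ring

lemma contRate_nonneg (d : ℕ) (β : ℝ≥0) (n : ℕ) : 0 ≤ contRate d β n := by
  unfold contRate
  positivity

lemma tendsto_contRate (d : ℕ) (hβ : 0 < β) : Tendsto (contRate d β) atTop (𝓝 0) := by
  have h0 := two_mul_add_pos d hβ
  have hβ' : 0 < (β : ℝ) := hβ
  have h := (tendsto_log_mul_rpow_neg (a := 2 * ((β : ℝ) / (2 * β + d))) (by positivity)).sqrt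
  rw [Real.sqrt_zero] at h
  refine h.congr fun n => ?_
  rw [← contRate_sq, Real.sqrt_sq (contRate_nonneg d β n)]

lemma one_le_log_natCast {n : ℕ} (hn : 3 ≤ n) : 1 ≤ Real.log n := by
  rw [Real.le_log_iff_exp_le (by positivity)]
  have : (3 : ℝ) ≤ n := by exact_mod_cast hn
  linarith [Real.exp_one_lt_d9]

lemma rpow_le_contRate (d : ℕ) (β : ℝ≥0) {n : ℕ} (hn : 3 ≤ n) :
    (n : ℝ) ^ (-((β : ℝ) / (2 * β + d))) ≤ contRate d β n :=
  le_mul_of_one_le_left (by positivity) (Real.one_le_sqrt.2 (one_le_log_natCast hn))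

lemma eventually_contRate_pos (d : ℕ) (β : ℝ≥0) : ∀ᶠ n in atTop, 0 < contRate d β n := by
  filter_upwards [eventually_ge_atTop 3] with n hn
  refine lt_of_lt_of_le (Real.rpow_pos_of_pos ?_ _) (rpow_le_contRate d β hn)
  positivity

lemma integral_density_eq_one (hf : Continuous f) (hf0 : ∀ t, 0 ≤ f t)
    [IsProbabilityMeasure (densityMeasure f)] : ∫ y, f y = 1 := by
  have := integral_densityMeasure hf hf0 fun _ => 1
  simpa using this.symm

/-- On a one-point space the estimator is exact. -/
lemma kde_eq_of_dim_zero {K f : E 0 → ℝ} (hK : IsKernel K) (hf : Continuous f)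
    (hf0 : ∀ t, 0 ≤ f t) [IsProbabilityMeasure (densityMeasure f)] {n : ℕ} (hn : n ≠ 0)
    (X : Fin n → E 0) (h : ℝ) (t : E 0) : kde K X h t = f t := by
  have e : ∀ (g : E 0 → ℝ) (u : E 0), g u = g 0 := fun g u => by rw [Subsingleton.elim u 0]
  have h1 := hK.integral_eq_one
  have h2 := integral_density_eq_one hf hf0
  rw [integral_congr_ae (ae_of_all _ (e K)), integral_const, smul_eq_mul] at h1
  rw [integral_congr_ae (ae_of_all _ (e f)), integral_const, smul_eq_mul, ← h1] at h2
  have h3 : f 0 = K 0 := by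
    refine mul_left_cancel₀ (fun hz => ?_) h2
    rw [hz, zero_mul] at h1
    exact zero_ne_one h1
  rw [e f, h3]
  simp only [kde, e K, Finset.sum_const, Finset.card_univ, Fintype.card_fin, pow_zero, mul_one,
    nsmul_eq_mul]
  field_simp

/-- The kernel density estimator has uniform precision of order `contRate` on bounded sets:
polynomially many points of a grid suffice, and the local deviation bound beats every polynomial
once the constant `M` is large. -/
theorem exists_tendsto_measure_kde_deviation (hK : IsKernel K) (hf : Continuous f)
    (hf0 : ∀ t, 0 ≤ f t) [IsProbabilityMeasure (densityMeasure f)] (hβ : 0 < β) (hβ1 : β ≤ 1)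
    (hL : HolderWith L β f) {C : Set (E d)} (hC : Bornology.IsBounded C) {h : ℕ → ℝ}
    (hh : ∀ n, 0 < h n) (hord : h =Θ[atTop] fun n : ℕ => (n : ℝ) ^ (-(1 / (2 * (β : ℝ) + d))))
    {X : (n : ℕ) → Fin n → Ω → E d} (hX : ∀ n i, Measurable (X n i))
    (hlaw : ∀ n i, P.map (X n i) = densityMeasure f) (hind : ∀ n, iIndepFun (X n) P) :
    ∃ M : ℝ, 0 < M ∧ Tendsto (fun n => P {ω | ∃ t ∈ C, M * contRate d β n <
      |kde K (fun i => X n i ω) (h n) t - f t|}) atTop (𝓝 0) := by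
  classical
  rcases eq_or_ne d 0 with rfl | hd
  · refine ⟨1, one_pos, tendsto_const_nhds.congr' ?_⟩
    filter_upwards [eventually_ne_atTop 0] with n hn
    refine (measure_mono_null ?_ (measure_empty (μ := P))).symm
    rintro ω ⟨t, -, ht⟩
    rw [kde_eq_of_dim_zero hK hf hf0 hn, sub_self, abs_zero] at ht
    exact absurd ht (not_lt.2 (mul_nonneg zero_le_one (contRate_nonneg 0 β n)))
  have hβ' : 0 < (β : ℝ) := hβ
  have hβ1' : (β : ℝ) ≤ 1 := hβ1
  have hL' : ∀ y z, |f y - f z| ≤ L * ‖y - z‖ ^ (β : ℝ) := fun y z => by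
    simpa [Real.dist_eq, dist_eq_norm] using hL.dist_le y z
  have hden := two_mul_add_pos d hβ
  have hd1 : (1 : ℝ) ≤ d := by exact_mod_cast Nat.one_le_iff_ne_zero.2 hd
  set γ : ℝ := 1 / (2 * (β : ℝ) + d) with hγ
  set α : ℝ := (β : ℝ) / (2 * β + d) with hα
  have hγ0 : 0 < γ := by positivity
  have hγ1 : γ ≤ 1 := by rw [hγ, div_le_one hden]; linarith
  have hα1 : α ≤ 1 := by rw [hα, div_le_one hden]; linarith
  have hαγ : γ * β = α := by rw [hγ, hα]; ring
  have hbal : -(2 * α) + 1 + -γ * d = 0 := by rw [hγ, hα]; field_simp; ring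
  obtain ⟨R, hR, hCR⟩ := hC.subset_closedBall_lt 0 0
  obtain ⟨F, hF⟩ := (isCompact_closedBall (0 : E d) (R + 1)).bddAbove_image hf.continuousOn
  have hF' : ∀ s : E d, ‖s‖ ≤ R + 1 → f s ≤ F := fun s hs =>
    hF ⟨s, by simpa using hs, rfl⟩
  have hF0 : 0 ≤ F := (hf0 0).trans (hF' 0 (by simp; linarith))
  obtain ⟨A, B, hA, hB, hAB⟩ := exists_measure_local_deviation_le (P := P) hd hK hf hf0 hβ'.le
    hβ1' L.2 hL' hF0
  obtain ⟨c₂, hc₂, hup⟩ := hord.1.exists_pos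
  obtain ⟨c₁', hc₁', hlow⟩ := hord.2.exists_pos
  set c₁ := c₁'⁻¹ with hc₁
  have hc₁0 : 0 < c₁ := inv_pos.2 hc₁'
  set M' := B + (6 * d + 1) / c₁ ^ d with hM'
  have hM'0 : 0 ≤ M' := by positivity
  refine ⟨M' + A * (1 + c₂ ^ (β : ℝ)) + 1, by positivity, ?_⟩
  have hlim : Tendsto (fun n : ℕ => ENNReal.ofReal (4 / n)) atTop (𝓝 0) := by
    simpa using ENNReal.tendsto_ofReal (tendsto_const_div_atTop_nhds_zero_nat 4)
  refine tendsto_of_tendsto_of_tendsto_of_le_of_le' tendsto_const_nhds hlim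
    (Eventually.of_forall fun _ => zero_le) ?_
  have hpow0 : Tendsto (fun n : ℕ => c₂ * (n : ℝ) ^ (-γ)) atTop (𝓝 0) := by
    simpa using ((tendsto_rpow_neg_atTop hγ0).comp tendsto_natCast_atTop_atTop).const_mul c₂
  have hrate0 : Tendsto (fun n => 4 * K 0 * contRate d β n) atTop (𝓝 0) := by
    simpa using (tendsto_contRate d hβ).const_mul (4 * K 0)
  filter_upwards [hup.bound, hlow.bound, hpow0.eventually_le_const one_pos,
    hrate0.eventually_le_const one_pos, eventually_ge_atTop 3,
    tendsto_natCast_atTop_atTop.eventually_ge_atTop (R + 1),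
    tendsto_natCast_atTop_atTop.eventually_ge_atTop (d / c₁),
    eventually_ge_atTop d] with n hn1 hn2 hn3 hn4 hn5 hn6 hn7 hn8
  have hn0 : (0 : ℝ) < n := by positivity
  have hn3' : (3 : ℝ) ≤ n := by exact_mod_cast hn5
  have hn1' : (1 : ℝ) ≤ n := by linarith
  have hd0 : 0 < h n ^ d := pow_pos (hh n) d
  rw [Real.norm_of_nonneg (hh n).le, Real.norm_of_nonneg (by positivity)] at hn1 hn2
  have hlo : c₁ * (n : ℝ) ^ (-γ) ≤ h n := by
    rw [hc₁, inv_mul_le_iff₀ hc₁']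
    exact hn2
  have hlo' : c₁ / n ≤ h n := by
    refine le_trans ?_ hlo
    rw [div_eq_mul_inv, ← Real.rpow_neg_one]
    gcongr
  have hh1 : h n ≤ 1 := hn1.trans hn3
  have hρ := rpow_le_contRate d β hn5
  rw [← hα] at hρ
  set ρ := contRate d β n with hρdef
  have hρ0 : 0 ≤ ρ := contRate_nonneg d β n
  have hδρ : 1 / (n : ℝ) ≤ ρ := by
    refine le_trans ?_ hρ
    rw [one_div, ← Real.rpow_neg_one]
    gcongr
  have hhρ : h n ^ (β : ℝ) ≤ c₂ ^ (β : ℝ) * ρ := by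
    calc h n ^ (β : ℝ) ≤ (c₂ * (n : ℝ) ^ (-γ)) ^ (β : ℝ) := by
          have := (hh n).le
          gcongr
      _ = c₂ ^ (β : ℝ) * (n : ℝ) ^ (-α) := by
          rw [Real.mul_rpow hc₂.le (by positivity), ← Real.rpow_mul hn0.le, neg_mul, hαγ]
      _ ≤ _ := by gcongr
  have hexp : (6 * d + 1) * Real.log n ≤ ρ * (M' * ρ - B * ρ) * (n * h n ^ d) := by
    have e1 : ρ * (M' * ρ - B * ρ) * (n * h n ^ d) =
        (6 * d + 1) / c₁ ^ d * (Real.log n * ((n : ℝ) ^ (-(2 * α)) * n * h n ^ d)) := by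
      have := contRate_sq d β n
      rw [← hρdef, ← hα] at this
      have e2 : ρ * (M' * ρ - B * ρ) * (n * h n ^ d) =
        (6 * d + 1) / c₁ ^ d * (ρ ^ 2 * n * h n ^ d) := by rw [hM']; ring
      rw [e2, this]
      ring
    have e3 : c₁ ^ d ≤ (n : ℝ) ^ (-(2 * α)) * n * h n ^ d := by
      calc c₁ ^ d = c₁ ^ d * (n : ℝ) ^ (-(2 * α) + 1 + -γ * d) := by
            rw [hbal, Real.rpow_zero, mul_one]
        _ = (n : ℝ) ^ (-(2 * α)) * n * (c₁ * (n : ℝ) ^ (-γ)) ^ d := by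
            rw [Real.rpow_add hn0, Real.rpow_add hn0, Real.rpow_one, mul_pow,
              Real.rpow_mul hn0.le, Real.rpow_natCast]
            ring
        _ ≤ _ := by gcongr
    have hlog := Real.log_natCast_nonneg n
    rw [e1]
    calc (6 * d + 1) * Real.log n = (6 * d + 1) / c₁ ^ d * (Real.log n * c₁ ^ d) := by
          field_simp
      _ ≤ _ := by gcongr
  -- a grid with mesh of order `n⁻⁴` is fine enough, since `h n` is at least of order `n⁻¹`
  have hq : R * ((n ^ 4 : ℕ) : ℝ) + 1 ≤ ((n ^ 5 : ℕ) : ℝ) := by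
    push_cast
    have : (1 : ℝ) ≤ (n : ℝ) ^ 4 := one_le_pow₀ hn1'
    nlinarith
  obtain ⟨N, hNcard, hN⟩ := exists_grid_net d (p := n ^ 4) (by positivity) hq
  have hmesh : (d : ℝ) / ((n ^ 4 : ℕ) : ℝ) ≤ (1 / n) ^ 2 * h n := by
    push_cast
    have h1 : (d : ℝ) ≤ c₁ * n := by
      rw [div_le_iff₀ hc₁0] at hn7
      linarith
    calc (d : ℝ) / (n : ℝ) ^ 4 ≤ c₁ * n / (n : ℝ) ^ 4 := by gcongr
      _ = (1 / n) ^ 2 * (c₁ / n) := by field_simp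
      _ ≤ _ := by gcongr
  have hmesh1 : (d : ℝ) / ((n ^ 4 : ℕ) : ℝ) ≤ 1 := by
    refine hmesh.trans (mul_le_one₀ (pow_le_one₀ (by positivity) ?_) (hh n).le hh1)
    rw [div_le_one hn0]
    exact hn1'
  have hcard : (N.card : ℝ) ≤ (n : ℝ) ^ (6 * d) := by
    have h1 : 2 * n ^ 5 + 1 ≤ n ^ 6 := by
      have : 1 ≤ n ^ 5 := Nat.one_le_pow _ _ (by lia)
      calc 2 * n ^ 5 + 1 ≤ 3 * n ^ 5 := by lia
        _ ≤ n * n ^ 5 := by gcongr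
        _ = n ^ 6 := by ring
    have h2 : N.card ≤ n ^ (6 * d) := by
      rw [pow_mul]
      exact hNcard.trans (Nat.pow_le_pow_left h1 d)
    exact_mod_cast h2
  let bad : E d → Set Ω := fun s => {ω | ∃ t, ‖t - s‖ ≤ (1 / (n : ℝ)) ^ 2 * h n ∧
    M' * ρ + A * (1 / n + h n ^ (β : ℝ)) < |kde K (fun i => X n i ω) (h n) t - f t|}
  have hsub : {ω | ∃ t ∈ C, (M' + A * (1 + c₂ ^ (β : ℝ)) + 1) * ρ <
      |kde K (fun i => X n i ω) (h n) t - f t|} ⊆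
      ⋃ s ∈ N.filter (fun s => ‖s‖ ≤ R + 1), bad s := by
    rintro ω ⟨t, htC, ht⟩
    have htR : ‖t‖ ≤ R := by simpa using hCR htC
    obtain ⟨s, hsN, hts⟩ := hN t htR
    simp only [Set.mem_iUnion]
    refine ⟨s, Finset.mem_filter.2 ⟨hsN, ?_⟩, t, hts.trans hmesh, lt_of_le_of_lt ?_ ht⟩
    · have := norm_sub_le t (t - s)
      rw [sub_sub_cancel] at this
      linarith
    · have : A * (1 / n + h n ^ (β : ℝ)) ≤ A * (ρ + c₂ ^ (β : ℝ) * ρ) := by gcongr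
      linarith
  have hhalf : 1 / (n : ℝ) ≤ 1 / 2 := by
    gcongr
    linarith
  have hbad : ∀ s ∈ N.filter (fun s => ‖s‖ ≤ R + 1),
      P (bad s) ≤ 4 * ENNReal.ofReal (((n : ℝ) ^ (6 * d + 1))⁻¹) := fun s hs => by
    refine (hAB n (X n) s (h n) (1 / n) ρ (M' * ρ) (by lia) (hX n) (hlaw n) (hind n)
      (hF' s (Finset.mem_filter.1 hs).2) (hh n) hh1 (by positivity) hhalf hρ0 hn4).trans ?_
    gcongr
    rw [← Real.exp_log (x := (n : ℝ) ^ (6 * d + 1)) (by positivity), ← Real.exp_neg,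
      Real.log_pow]
    push_cast
    gcongr
  calc P _ ≤ P (⋃ s ∈ N.filter (fun s => ‖s‖ ≤ R + 1), bad s) := measure_mono hsub
    _ ≤ ∑ s ∈ N.filter (fun s => ‖s‖ ≤ R + 1), P (bad s) := measure_biUnion_finset_le _ _
    _ ≤ ∑ _s ∈ N.filter (fun s => ‖s‖ ≤ R + 1),
        4 * ENNReal.ofReal (((n : ℝ) ^ (6 * d + 1))⁻¹) := Finset.sum_le_sum hbad
    _ ≤ N.card * (4 * ENNReal.ofReal (((n : ℝ) ^ (6 * d + 1))⁻¹)) := by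
        rw [Finset.sum_const, nsmul_eq_mul]
        gcongr
        exact Finset.filter_subset _ _
    _ = ENNReal.ofReal (N.card * (4 * ((n : ℝ) ^ (6 * d + 1))⁻¹)) := by
        rw [ENNReal.ofReal_mul (by positivity), ENNReal.ofReal_mul (by norm_num),
          ENNReal.ofReal_natCast]
        norm_num
    _ ≤ ENNReal.ofReal (4 / n) := by
        refine ENNReal.ofReal_le_ofReal ?_
        calc (N.card : ℝ) * (4 * ((n : ℝ) ^ (6 * d + 1))⁻¹)
            ≤ (n : ℝ) ^ (6 * d) * (4 * ((n : ℝ) ^ (6 * d + 1))⁻¹) := by gcongr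
          _ = 4 / n := by
              rw [pow_succ]
              field_simp

end Uniform

/-! ### Stochastic orders from events of high probability -/

section HighProb

variable {Ω : Type*} [MeasurableSpace Ω] {P : Measure Ω} {G : ℕ → ℝ → Set Ω} {Z : ℕ → Ω → ℝ}

/-- The events `G n M` have probability close to one for a suitable constant `M` and all large
`n`. No measurability is required: the outer measure of the complement is small. -/
def IsHighProb (P : Measure Ω) (G : ℕ → ℝ → Set Ω) : Prop :=
  ∀ δ : ℝ, 0 < δ → ∃ M : ℝ, 0 < M ∧ ∀ᶠ n in atTop, P (G n M)ᶜ ≤ ENNReal.ofReal δ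

lemma IsHighProb.isBigOP (hG : IsHighProb P G) {a : ℕ → ℝ} (ha : ∀ᶠ n in atTop, 0 < a n)
    (hZ : ∀ M, 0 < M → ∃ M', ∀ᶠ n in atTop, ∀ ω ∈ G n M, |Z n ω| ≤ M' * a n) :
    IsBigOP P Z a := by
  intro ε hε
  obtain ⟨M, hM, hP⟩ := hG (ε / 2) (by positivity)
  obtain ⟨M', hM'⟩ := hZ M hM
  refine ⟨|M'| + 1, by positivity, lt_of_le_of_lt (b := ENNReal.ofReal (ε / 2)) ?_ ?_⟩
  · refine limsup_le_of_le (by isBoundedDefault) ?_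
    filter_upwards [ha, hP, hM'] with n h1 h2 h3
    refine (measure_mono fun ω hω hωG => ?_).trans h2
    have h4 := h3 ω hωG
    simp only [Set.mem_ofPred_eq] at hω
    rw [le_div_iff₀ h1] at hω
    nlinarith [le_abs_self M']
  · exact (ENNReal.ofReal_lt_ofReal_iff hε).2 (by linarith)

lemma IsHighProb.tendsto_measure_zero (hG : IsHighProb P G) {s : ℕ → Set Ω}
    (hs : ∀ M, 0 < M → ∀ᶠ n in atTop, ∀ ω ∈ G n M, ω ∉ s n) :
    Tendsto (fun n => P (s n)) atTop (𝓝 0) := by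
  refine ENNReal.tendsto_nhds_zero.2 fun ε hε => ?_
  obtain ⟨δ, hδ, hδε⟩ : ∃ δ : ℝ, 0 < δ ∧ ENNReal.ofReal δ ≤ ε := by
    obtain ⟨q, hq0, hq⟩ := ENNReal.lt_iff_exists_nnreal_btwn.1 hε
    refine ⟨q, by exact_mod_cast hq0, ?_⟩
    rw [ENNReal.ofReal_coe_nnreal]
    exact hq.le
  obtain ⟨M, hM, hP⟩ := hG δ hδ
  filter_upwards [hP, hs M hM] with n h1 h2
  exact (measure_mono fun ω hω hωG => h2 ω hωG hω).trans (h1.trans hδε)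

lemma IsHighProb.tendstoInMeasure_zero (hG : IsHighProb P G)
    (hZ : ∀ M, 0 < M → ∀ c : ℝ, 0 < c → ∀ᶠ n in atTop, ∀ ω ∈ G n M, |Z n ω| < c) :
    TendstoInMeasure P Z atTop fun _ => 0 := by
  rw [tendstoInMeasure_iff_norm]
  intro c hc
  refine hG.tendsto_measure_zero fun M hM => ?_
  filter_upwards [hZ M hM c hc] with n hn ω hω
  simpa using hn ω hω

lemma IsHighProb.tendstoInProbTop [IsProbabilityMeasure P] (hG : IsHighProb P G)
    (hZ : ∀ M, 0 < M → ∀ c : ℝ, 0 < c → ∀ᶠ n in atTop, ∀ ω ∈ G n M, c ≤ Z n ω) :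
    TendstoInProbTop P Z := by
  intro c hc
  have h0 : Tendsto (fun n => P {ω | c ≤ Z n ω}ᶜ) atTop (𝓝 0) :=
    hG.tendsto_measure_zero fun M hM => by
      filter_upwards [hZ M hM c hc] with n hn ω hω
      simpa using hn ω hω
  have h1 : Tendsto (fun n => 1 - P {ω | c ≤ Z n ω}ᶜ) atTop (𝓝 1) := by
    simpa using ENNReal.Tendsto.sub tendsto_const_nhds h0 (Or.inl ENNReal.one_ne_top)
  refine tendsto_of_tendsto_of_tendsto_of_le_of_le h1 tendsto_const_nhds (fun n => ?_)
    fun n => prob_le_one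
  rw [tsub_le_iff_right, ← measure_univ (μ := P), ← Set.union_compl_self {ω | c ≤ Z n ω}]
  exact measure_union_le _ _

end HighProb

/-! ### Perturbation of the truncated log-ratio -/

section LogRatio

variable {a b a' b' r t : ℝ}

lemma abs_log_sub_log_le {x y : ℝ} (ht : 0 < t) (hx : t ≤ x) (hy : t ≤ y) :
    |Real.log x - Real.log y| ≤ |x - y| / t := by
  have key : ∀ u v : ℝ, t ≤ u → t ≤ v → Real.log u - Real.log v ≤ |u - v| / t := by
    intro u v hu hv
    have hu0 : 0 < u := ht.trans_le hu
    have hv0 : 0 < v := ht.trans_le hv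
    rw [← Real.log_div hu0.ne' hv0.ne']
    calc Real.log (u / v) ≤ u / v - 1 := Real.log_le_sub_one_of_pos (by positivity)
      _ = (u - v) / v := by field_simp
      _ ≤ |u - v| / v := by gcongr; exact le_abs_self _
      _ ≤ |u - v| / t := by gcongr
  refine abs_sub_le_iff.2 ⟨key x y hx hy, ?_⟩
  rw [abs_sub_comm]
  exact key y x hy hx

/-- Truncation from below does not increase log-ratios. -/
lemma abs_log_max_sub_log_max_le (ha : 0 ≤ a) (hb : 0 ≤ b) (hab : a = 0 ↔ b = 0) (ht : 0 < t) :
    |Real.log (max a t) - Real.log (max b t)| ≤ |Real.log a - Real.log b| := by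
  rcases ha.eq_or_lt with ha0 | ha0
  · rw [← ha0, hab.1 ha0.symm, sub_self, sub_self]
  · have hb0 : 0 < b := hb.lt_of_ne fun h => ha0.ne' (hab.2 h.symm)
    have hm : ∀ u : ℝ, 0 < u → Real.log (max u t) = max (Real.log u) (Real.log t) := fun u hu =>
      Real.strictMonoOn_log.monotoneOn.map_max hu ht
    rw [hm a ha0, hm b hb0]
    exact abs_max_sub_max_le_abs _ _ _

lemma abs_log_max_sub_log_max_le_add (ha : 0 ≤ a) (hb : 0 ≤ b) (hab : a = 0 ↔ b = 0)
    (ht : 0 < t) (ha' : |a' - a| ≤ r) (hb' : |b' - b| ≤ r) :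
    |Real.log (max a' t) - Real.log (max b' t)| ≤
      |Real.log a - Real.log b| + 2 * (r / t) := by
  have h : ∀ u v : ℝ, |u - v| ≤ r → |Real.log (max u t) - Real.log (max v t)| ≤ r / t :=
    fun u v huv => by
      refine (abs_log_sub_log_le ht (le_max_right _ _) (le_max_right _ _)).trans ?_
      gcongr
      exact (abs_max_sub_max_le_abs _ _ _).trans huv
  have h1 := abs_le.1 (h a' a ha')
  have h2 := abs_le.1 (h b' b hb')
  have h3 := abs_le.1 (abs_log_max_sub_log_max_le ha hb hab ht)
  exact abs_le.2 ⟨by linarith, by linarith⟩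

lemma abs_abs_log_max_sub_le {δ : ℝ} (hδ : 0 < δ) (ha : δ ≤ a) (hb : δ ≤ b) (hr : r ≤ δ / 2)
    (ht : t ≤ δ / 2) (ha' : |a' - a| ≤ r) (hb' : |b' - b| ≤ r) :
    abs (|Real.log (max a' t) - Real.log (max b' t)| - |Real.log a - Real.log b|) ≤
      4 / δ * r := by
  have h : ∀ u v : ℝ, δ ≤ v → |u - v| ≤ r →
      |Real.log (max u t) - Real.log v| ≤ 2 / δ * r := fun u v hv huv => by
    have hu : δ / 2 ≤ u := by linarith [(abs_le.1 huv).1]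
    rw [max_eq_left (ht.trans hu)]
    refine (abs_log_sub_log_le (half_pos hδ) hu (by linarith)).trans ?_
    rw [div_div_eq_mul_div, div_le_iff₀ hδ]
    field_simp
    exact huv
  have h1 := abs_le.1 (h a' a ha ha')
  have h2 := abs_le.1 (h b' b hb hb')
  refine (abs_abs_sub_abs_le _ _).trans (abs_le.2 ?_)
  have e : 4 / δ * r = 2 / δ * r + 2 / δ * r := by ring
  constructor <;> linarith

/-- The truncated log-ratio is large if one estimate falls below a small floor and the other one
stays away from zero. -/
lemma le_abs_log_max_sub_log_max {c : ℝ} (ht : 0 < t) (hb : 0 < b) (ha' : a' ≤ t)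
    (hb' : |b' - b| ≤ b / 2) (htc : t ≤ Real.exp (-c) * (b / 2)) :
    c ≤ |Real.log (max a' t) - Real.log (max b' t)| := by
  rw [max_eq_right ha']
  have h1 : Real.log t ≤ -c + Real.log (b / 2) := by
    have := Real.log_le_log ht htc
    rwa [Real.log_mul (Real.exp_pos _).ne' (by positivity), Real.log_exp] at this
  have h2 : Real.log (b / 2) ≤ Real.log (max b' t) :=
    Real.log_le_log (by positivity) (le_max_of_le_left (by linarith [(abs_le.1 hb').1]))
  rw [abs_sub_comm]
  exact le_trans (by linarith) (le_abs_self _)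

lemma logDist_toReal_of_ne_top (h : logDist a b ≠ ∞) :
    (logDist a b).toReal = |Real.log a - Real.log b| ∧ (a = 0 ↔ b = 0) := by
  unfold logDist at *
  split_ifs at * with h1 h2
  · simp [h1.1, h1.2]
  · exact absurd rfl h
  · rw [ENNReal.toReal_ofReal (abs_nonneg _)]
    tauto

lemma logDist_eq_top (h : logDist a b = ∞) : (a = 0 ∧ b ≠ 0) ∨ (a ≠ 0 ∧ b = 0) := by
  unfold logDist at h
  split_ifs at h with h1 h2
  · exact absurd h ENNReal.zero_ne_top
  · tauto
  · exact absurd h ENNReal.ofReal_ne_top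

end LogRatio

/-! ### Maximization of the empirical loss -/

section Argmax

variable {𝒴 : Type*} {C : Set 𝒴}

/-- If the perturbed objective `L'` is `a`-close to `L` wherever `L` is nearly maximal, and
elsewhere does not exceed `L` by much, then its maximum and its maximizer are `a`-precise. -/
lemma IsArgmaxOn.abs_sub_le {L L' : 𝒴 → ℝ} {e a η : ℝ} {s t : 𝒴} (ht : IsArgmaxOn L' C t)
    (hub : ∀ y ∈ C, L y ≤ e) (hs : s ∈ C) (hse : L s = e) (hη : 0 < η)
    (hclose : ∀ y ∈ C, e - η < L y → |L' y - L y| ≤ a)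
    (hup : ∀ y ∈ C, L' y ≤ L y + η / 2) (ha : a < η / 2) :
    |L' t - e| ≤ a ∧ |L t - e| ≤ 2 * a := by
  have h1 := (abs_le.1 (hclose s hs (by linarith))).1
  have h2 : L' s ≤ L' t := ht.2 hs
  have h3 := hup t ht.1
  have h4 := abs_le.1 (hclose t ht.1 (by linarith))
  have h5 := hub t ht.1
  exact ⟨abs_le.2 ⟨by linarith, by linarith⟩, abs_le.2 ⟨by linarith, by linarith⟩⟩

lemma loss_le_maxLoss (f g : 𝒴 → ℝ) {t : 𝒴} (ht : t ∈ C) : loss f g t ≤ maxLoss f g C :=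
  le_iSup₂ (f := fun t _ => loss f g t) t ht

lemma IsArgmaxOn.loss_eq_maxLoss {f g : 𝒴 → ℝ} {t : 𝒴} (ht : IsArgmaxOn (loss f g) C t) :
    loss f g t = maxLoss f g C :=
  le_antisymm (loss_le_maxLoss f g ht.1) (iSup₂_le fun _ hy => ht.2 hy)

lemma loss_toReal_of_maxLoss_ne_top {f g : 𝒴 → ℝ} (h : maxLoss f g C ≠ ∞) {t : 𝒴}
    (ht : t ∈ C) :
    (loss f g t).toReal = |Real.log (f t) - Real.log (g t)| ∧ (f t = 0 ↔ g t = 0) :=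
  logDist_toReal_of_ne_top (ne_top_of_le_ne_top h (loss_le_maxLoss f g ht))

variable {Ω : Type*} [MeasurableSpace Ω] {P : Measure Ω} [IsProbabilityMeasure P]

/-- Behaviour of the empirical maximum loss for density estimates that are truncated below at
`τ → 0` and uniformly `a`-precise before truncation. The maximum loss has to be attained
(`hatt`), nearly maximal losses must occur only where both densities are bounded away from zero
(`hsep`), and the empirical loss must not exceed the loss by a fixed amount (`hup`). -/
theorem empLoss_argmax_asymptotics {f g : 𝒴 → ℝ} (hf0 : ∀ t, 0 ≤ f t) (hg0 : ∀ t, 0 ≤ g t)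
    {fh gh : ℕ → Ω → 𝒴 → ℝ} {a τ : ℕ → ℝ} {G : ℕ → ℝ → Set Ω} {that : ℕ → Ω → 𝒴}
    (hG : IsHighProb P G) (hapos : ∀ᶠ n in atTop, 0 < a n) (ha : Tendsto a atTop (𝓝 0))
    (hτ0 : ∀ n, 0 < τ n) (hτ : Tendsto τ atTop (𝓝 0))
    (hclose : ∀ M, 0 < M → ∀ n, ∀ ω ∈ G n M, ∀ t ∈ C,
      |fh n ω t - f t| ≤ M * a n ∧ |gh n ω t - g t| ≤ M * a n)
    (hzero : ∀ M, 0 < M → ∀ᶠ n in atTop, ∀ ω ∈ G n M, ∀ t ∈ C,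
      (f t = 0 → fh n ω t ≤ τ n) ∧ (g t = 0 → gh n ω t ≤ τ n))
    (hup : maxLoss f g C ≠ ∞ → ∀ M, 0 < M → ∀ c : ℝ, 0 < c → ∀ᶠ n in atTop, ∀ ω ∈ G n M,
      ∀ t ∈ C, empLoss (fun t => max (fh n ω t) (τ n)) (fun t => max (gh n ω t) (τ n)) t ≤
        (loss f g t).toReal + c)
    (hatt : ∃ t ∈ C, loss f g t = maxLoss f g C)
    (hsep : 0 < maxLoss f g C → maxLoss f g C ≠ ∞ → ∃ η δ : ℝ, 0 < η ∧ 0 < δ ∧ ∀ t ∈ C,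
      (maxLoss f g C).toReal - η < (loss f g t).toReal → δ ≤ f t ∧ δ ≤ g t)
    (harg : ∀ n ω, IsArgmaxOn (empLoss (fun t => max (fh n ω t) (τ n))
      (fun t => max (gh n ω t) (τ n))) C (that n ω)) :
    (0 < maxLoss f g C ∧ maxLoss f g C < ∞ →
      IsBigOP P (fun n ω => |empLoss (fun t => max (fh n ω t) (τ n))
        (fun t => max (gh n ω t) (τ n)) (that n ω) - (maxLoss f g C).toReal|) a ∧
      IsBigOP P (fun n ω => |(loss f g (that n ω)).toReal - (maxLoss f g C).toReal|) a) ∧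
    (maxLoss f g C = 0 → TendstoInMeasure P (fun n ω => empLoss (fun t => max (fh n ω t) (τ n))
        (fun t => max (gh n ω t) (τ n)) (that n ω)) atTop fun _ => 0) ∧
    (maxLoss f g C = ∞ → TendstoInProbTop P fun n ω => empLoss (fun t => max (fh n ω t) (τ n))
        (fun t => max (gh n ω t) (τ n)) (that n ω)) := by
  have hMa : ∀ M : ℝ, Tendsto (fun n => M * a n) atTop (𝓝 0) := fun M => by
    simpa using ha.const_mul M
  refine ⟨fun hε => ?_, fun hε => ?_, fun hε => ?_⟩
  · have hfin := hε.2.ne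
    obtain ⟨s, hs, hse⟩ := hatt
    obtain ⟨η, δ, hη, hδ, hsepδ⟩ := hsep hε.1 hfin
    have key : ∀ M, 0 < M → ∀ᶠ n in atTop, ∀ ω ∈ G n M,
        |empLoss (fun t => max (fh n ω t) (τ n)) (fun t => max (gh n ω t) (τ n)) (that n ω) -
          (maxLoss f g C).toReal| ≤ 4 / δ * (M * a n) ∧
        |(loss f g (that n ω)).toReal - (maxLoss f g C).toReal| ≤ 2 * (4 / δ * (M * a n)) := by
      intro M hM
      have h4 : Tendsto (fun n => 4 / δ * (M * a n)) atTop (𝓝 0) := by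
        simpa using (hMa M).const_mul (4 / δ)
      filter_upwards [hup hfin M hM (η / 2) (half_pos hη), h4.eventually_lt_const (half_pos hη),
        (hMa M).eventually_le_const (half_pos hδ), hτ.eventually_le_const (half_pos hδ)]
        with n h1 h2 h3 h5 ω hω
      refine (harg n ω).abs_sub_le (L := fun t => (loss f g t).toReal)
        (fun y hy => ENNReal.toReal_mono hfin (loss_le_maxLoss f g hy)) hs (by rw [hse]) hη
        (fun y hy hyη => ?_) (h1 ω hω) h2
      obtain ⟨hfy, hgy⟩ := hsepδ y hy hyη
      obtain ⟨c1, c2⟩ := hclose M hM n ω hω y hy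
      rw [(loss_toReal_of_maxLoss_ne_top hfin hy).1]
      exact abs_abs_log_max_sub_le hδ hfy hgy h3 h5 c1 c2
    constructor
    · refine hG.isBigOP hapos fun M hM => ⟨4 / δ * M, ?_⟩
      filter_upwards [key M hM] with n hn ω hω
      rw [abs_abs, mul_assoc]
      exact (hn ω hω).1
    · refine hG.isBigOP hapos fun M hM => ⟨2 * (4 / δ * M), ?_⟩
      filter_upwards [key M hM] with n hn ω hω
      rw [abs_abs, mul_assoc, mul_assoc]
      exact (hn ω hω).2
  · refine hG.tendstoInMeasure_zero fun M hM c hc => ?_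
    filter_upwards [hup (by simp [hε]) M hM (c / 2) (half_pos hc)] with n hn ω hω
    have h1 := hn ω hω _ (harg n ω).1
    have h2 : loss f g (that n ω) = 0 := by
      simpa [hε] using loss_le_maxLoss f g (harg n ω).1
    rw [h2, ENNReal.toReal_zero, zero_add] at h1
    rw [abs_of_nonneg (by unfold empLoss; positivity)]
    linarith
  · obtain ⟨s, hs, hse⟩ := hatt
    rw [hε] at hse
    refine hG.tendstoInProbTop fun M hM c _ => ?_
    have hsmall : ∀ b : ℝ, 0 < b → ∀ᶠ n in atTop, M * a n ≤ b / 2 ∧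
        τ n ≤ Real.exp (-c) * (b / 2) := fun b hb =>
      ((hMa M).eventually_le_const (half_pos hb)).and
        (hτ.eventually_le_const (mul_pos (Real.exp_pos _) (half_pos hb)))
    rcases logDist_eq_top hse with ⟨hfs, hgs⟩ | ⟨hfs, hgs⟩
    · have hpos : 0 < g s := (hg0 s).lt_of_ne' hgs
      filter_upwards [hzero M hM, hsmall _ hpos] with n h1 h2 ω hω
      refine le_trans ?_ ((harg n ω).2 hs)
      exact le_abs_log_max_sub_log_max (hτ0 n) hpos ((h1 ω hω s hs).1 hfs)
        ((hclose M hM n ω hω s hs).2.trans h2.1) h2.2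
    · have hpos : 0 < f s := (hf0 s).lt_of_ne' hfs
      filter_upwards [hzero M hM, hsmall _ hpos] with n h1 h2 ω hω
      refine le_trans ?_ ((harg n ω).2 hs)
      refine (le_abs_log_max_sub_log_max (hτ0 n) hpos ((h1 ω hω s hs).2 hgs)
        ((hclose M hM n ω hω s hs).1.trans h2.1) h2.2).trans_eq ?_
      exact abs_sub_comm _ _

end Argmax

/-! ### The two samples -/

section SamplePair

variable {Ω 𝒴 : Type*} [MeasurableSpace Ω] [MeasurableSpace 𝒴] {P : Measure Ω}
  {ν ν' : Measure 𝒴} {n : ℕ} {X Y : Fin n → Ω → 𝒴}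

lemma IsSamplePair.indep_fst (h : IsSamplePair P ν ν' X Y) : iIndepFun X P :=
  iIndepFun.precomp (g := Sum.inl) Sum.inl_injective h.indep

lemma IsSamplePair.indep_snd (h : IsSamplePair P ν ν' X Y) : iIndepFun Y P :=
  iIndepFun.precomp (g := Sum.inr) Sum.inr_injective h.indep

end SamplePair

/-! ### Discrete algorithms -/

section Discrete

variable {Ω : Type*} [MeasurableSpace Ω] {P : Measure Ω}

/-- The relative frequency of the value `t` in a sample. -/
noncomputable def freq {n : ℕ} (X : Fin n → ℕ) (t : ℕ) : ℝ :=
  ((Finset.univ.filter (fun i => X i = t)).card : ℝ) / n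

lemma measure_freq_ne_zero {ν : Measure ℕ} [IsProbabilityMeasure ν] {n : ℕ}
    {X : Fin n → Ω → ℕ} (hX : ∀ i, Measurable (X i)) (hlaw : ∀ i, P.map (X i) = ν)
    {t : ℕ} (ht : ν.real {t} = 0) :
    P {ω | freq (fun i => X i ω) t ≠ 0} = 0 := by
  have h0 : ∀ i, P (X i ⁻¹' {t}) = 0 := fun i => by
    rw [← Measure.map_apply (hX i) (measurableSet_singleton t), hlaw i]
    rwa [measureReal_eq_zero_iff] at ht
  refine measure_mono_null (fun ω hω => ?_) (measure_iUnion_null h0)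
  by_contra hcon
  simp only [Set.mem_iUnion, Set.mem_preimage, Set.mem_singleton_iff, not_exists] at hcon
  exact hω (by simp [freq, hcon])

variable [IsProbabilityMeasure P]

lemma measure_freq_sub_gt_le {ν : Measure ℕ} [IsProbabilityMeasure ν] {n : ℕ} (hn : n ≠ 0)
    {X : Fin n → Ω → ℕ} (hX : ∀ i, Measurable (X i)) (hlaw : ∀ i, P.map (X i) = ν)
    (hind : iIndepFun X P) (t : ℕ) (M : ℝ) :
    P {ω | M * (n : ℝ) ^ (-(1 / 2) : ℝ) < |freq (fun i => X i ω) t - ν.real {t}|} ≤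
      2 * ENNReal.ofReal (Real.exp (1 / 4 - M / 2)) := by
  classical
  have hn0 : (0 : ℝ) < n := by positivity
  have hs0 : 0 < √(n : ℝ) := Real.sqrt_pos.2 hn0
  have hs1 : 1 ≤ √(n : ℝ) := Real.one_le_sqrt.2 (by exact_mod_cast Nat.one_le_iff_ne_zero.2 hn)
  have hss : √(n : ℝ) * √(n : ℝ) = n := Real.mul_self_sqrt hn0.le
  have hpow : (n : ℝ) ^ (-(1 / 2) : ℝ) = (√(n : ℝ))⁻¹ := by
    rw [Real.rpow_neg hn0.le, Real.sqrt_eq_rpow]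
  let g : ℕ → ℝ := ({t} : Set ℕ).indicator 1
  have hg : ∀ y, |g y| ≤ 1 := fun y => by
    by_cases hy : y = t <;> simp [g, hy]
  have hint : ∫ y, g y ∂ν = ν.real {t} := integral_indicator_one (measurableSet_singleton t)
  have hv : ∫ y, g y ^ 2 ∂ν ≤ 1 := by
    have : ∫ y, g y ^ 2 ∂ν ≤ ∫ _, (1 : ℝ) ∂ν :=
      integral_mono (integrable_of_abs_le (B := 1) (measurable_of_countable _) fun y => by
        rw [abs_pow]; exact pow_le_one₀ (abs_nonneg _) (hg y)) (integrable_const _) fun y => by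
        have := pow_le_one₀ (n := 2) (abs_nonneg _) (hg y)
        rwa [sq_abs] at this
    simpa using this
  have key := measure_abs_sum_sub_ge_le hX hlaw hind (measurable_of_countable g) hg hv
    (l := 1 / (2 * √(n : ℝ))) (by positivity) (by
      rw [mul_one, mul_one_div, div_le_one (by positivity)]
      linarith) (M * √(n : ℝ))
  have hexp : -(1 / (2 * √(n : ℝ))) * (M * √(n : ℝ)) + n * ((1 / (2 * √(n : ℝ))) ^ 2 * 1) =
      1 / 4 - M / 2 := by
    have h1 : n * ((1 / (2 * √(n : ℝ))) ^ 2 * 1) = 1 / 4 := by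
      rw [mul_one, div_pow, mul_pow, sq (√(n : ℝ)), hss]
      field_simp
      norm_num
    rw [h1]
    field_simp
    ring
  rw [hexp, hint] at key
  refine (measure_mono fun ω hω => ?_).trans key
  simp only [Set.mem_ofPred_eq] at hω ⊢
  have hsum : ∑ i, g (X i ω) = n * freq (fun i => X i ω) t := by
    rw [freq, mul_div_cancel₀ _ hn0.ne', Finset.card_filter]
    push_cast
    refine Finset.sum_congr rfl fun i _ => ?_
    by_cases hy : X i ω = t <;> simp [g, hy]
  rw [hsum, ← mul_sub, abs_mul, abs_of_pos hn0]
  rw [hpow] at hω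
  calc M * √(n : ℝ) = n * (M * (√(n : ℝ))⁻¹) := by
        nth_rewrite 2 [← hss]
        field_simp
    _ ≤ _ := by gcongr

/-- The event that the relative frequency of `t` is `M n^(-1/2)`-precise, and exact if `t` is
not a possible value. -/
def freqEvent (ν : Measure ℕ) (X : (n : ℕ) → Fin n → Ω → ℕ) (t n : ℕ) (M : ℝ) : Set Ω :=
  {ω | |freq (fun i => X n i ω) t - ν.real {t}| ≤ M * (n : ℝ) ^ (-(1 / 2) : ℝ) ∧
    (ν.real {t} = 0 → freq (fun i => X n i ω) t = 0)}

lemma measure_freqEvent_compl_le {ν : Measure ℕ} [IsProbabilityMeasure ν]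
    {X : (n : ℕ) → Fin n → Ω → ℕ} (hX : ∀ n i, Measurable (X n i))
    (hlaw : ∀ n i, P.map (X n i) = ν) (hind : ∀ n, iIndepFun (X n) P) (t : ℕ) {n : ℕ}
    (hn : n ≠ 0) (M : ℝ) :
    P (freqEvent ν X t n M)ᶜ ≤ 2 * ENNReal.ofReal (Real.exp (1 / 4 - M / 2)) := by
  have h1 := measure_freq_sub_gt_le hn (hX n) (hlaw n) (hind n) t M
  by_cases ht : ν.real {t} = 0
  · have h2 := measure_freq_ne_zero (hX n) (hlaw n) ht
    rw [← add_zero (2 * _), ← h2]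
    refine (measure_mono fun ω hω => ?_).trans
      ((measure_union_le _ _).trans (add_le_add_left h1 _))
    by_contra hcon
    simp only [Set.mem_union, Set.mem_ofPred_eq, not_or, not_lt, not_not] at hcon
    exact hω ⟨hcon.1, fun _ => hcon.2⟩
  · refine (measure_mono fun ω hω => ?_).trans h1
    by_contra hcon
    exact hω ⟨not_lt.1 hcon, fun h => absurd h ht⟩

lemma isHighProb_freqEvent {ν ν' : Measure ℕ} [IsProbabilityMeasure ν]
    [IsProbabilityMeasure ν'] {X Y : (n : ℕ) → Fin n → Ω → ℕ}
    (hXY : ∀ n, IsSamplePair P ν ν' (X n) (Y n)) (s : Finset ℕ) :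
    IsHighProb P fun n M => {ω | ∀ t ∈ s, ω ∈ freqEvent ν X t n M ∩ freqEvent ν' Y t n M} := by
  intro δ hδ
  have hlim : Tendsto (fun M : ℝ => s.card * (4 * Real.exp (1 / 4 - M / 2))) atTop (𝓝 0) := by
    have h1 : Tendsto (fun M : ℝ => 1 / 4 - M / 2) atTop atBot :=
      tendsto_atBot_add_const_left _ _ (tendsto_neg_atBot_iff.2
        (tendsto_id.atTop_div_const two_pos))
    simpa using ((Real.tendsto_exp_atBot.comp h1).const_mul 4).const_mul (s.card : ℝ)
  obtain ⟨M, hM, hM0⟩ := ((hlim.eventually_le_const hδ).and (eventually_gt_atTop 0)).exists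
  refine ⟨M, hM0, ?_⟩
  filter_upwards [eventually_ne_atTop 0] with n hn
  have hsub : {ω | ∀ t ∈ s, ω ∈ freqEvent ν X t n M ∩ freqEvent ν' Y t n M}ᶜ ⊆
      ⋃ t ∈ s, ((freqEvent ν X t n M)ᶜ ∪ (freqEvent ν' Y t n M)ᶜ) := by
    intro ω hω
    simp only [Set.mem_compl_iff, Set.mem_ofPred_eq, not_forall] at hω
    obtain ⟨t, ht, hωt⟩ := hω
    refine Set.mem_biUnion ht ?_
    rwa [← Set.compl_inter]
  calc P _ ≤ ∑ t ∈ s, P ((freqEvent ν X t n M)ᶜ ∪ (freqEvent ν' Y t n M)ᶜ) :=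
        (measure_mono hsub).trans (measure_biUnion_finset_le _ _)
    _ ≤ ∑ _t ∈ s, ENNReal.ofReal (4 * Real.exp (1 / 4 - M / 2)) := by
        refine Finset.sum_le_sum fun t _ => (measure_union_le _ _).trans ?_
        refine (add_le_add (measure_freqEvent_compl_le (fun n => (hXY n).measurable_fst)
          (fun n => (hXY n).law_fst) (fun n => (hXY n).indep_fst) t hn M)
          (measure_freqEvent_compl_le (fun n => (hXY n).measurable_snd)
          (fun n => (hXY n).law_snd) (fun n => (hXY n).indep_snd) t hn M)).trans_eq ?_
        rw [← add_mul, ENNReal.ofReal_mul (by norm_num)]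
        norm_num
    _ = ENNReal.ofReal (s.card * (4 * Real.exp (1 / 4 - M / 2))) := by
        rw [Finset.sum_const, nsmul_eq_mul, ENNReal.ofReal_mul (Nat.cast_nonneg _),
          ENNReal.ofReal_natCast]
    _ ≤ ENNReal.ofReal δ := ENNReal.ofReal_le_ofReal hM

lemma tendsto_floor_of_condD {τ : ℕ → ℝ} (hτ : CondD τ) : Tendsto τ atTop (𝓝 0) := by
  refine hτ.2.trans_tendsto ((tendsto_log_mul_rpow_neg one_half_pos).congr fun n => ?_)
  rw [Real.rpow_neg (by positivity), ← Real.sqrt_eq_rpow, div_eq_mul_inv]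

/-- On a finite set, positive values are bounded away from zero. -/
lemma exists_pos_lower_bound {ι : Type*} {s : Set ι} (hs : s.Finite) (f : ι → ℝ) :
    ∃ δ : ℝ, 0 < δ ∧ ∀ t ∈ s, 0 < f t → δ ≤ f t := by
  have h1 : ∀ t ∈ s, ∀ᶠ δ in 𝓝[>] (0 : ℝ), 0 < f t → δ ≤ f t := fun t _ => by
    by_cases ht : 0 < f t
    · filter_upwards [mem_nhdsWithin_of_mem_nhds (Iic_mem_nhds ht)] with δ hδ _ using hδ
    · exact Eventually.of_forall fun _ h => absurd h ht
  obtain ⟨δ, hδ, hδ0⟩ := ((hs.eventually_all.2 h1).and self_mem_nhdsWithin).exists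
  exact ⟨δ, hδ0, hδ⟩

end Discrete

/-! ### Continuous algorithms -/

section Continuous

variable {d : ℕ} {β : ℝ≥0}

lemma tendsto_floor_of_condC3 {h h' τ : ℕ → ℝ} (hβ : 0 < β) (hC3 : CondC3 d β h h' τ) :
    Tendsto τ atTop (𝓝 0) := by
  have hβ' : 0 < (β : ℝ) := hβ
  refine hC3.τ_upper.trans_tendsto ?_
  refine (tendsto_log_mul_rpow_neg (a := (β : ℝ) / (2 * β + d))
    (div_pos hβ' (two_mul_add_pos d hβ))).congr fun n => mul_comm _ _

/-- Close to the maximum loss, both densities stay away from zero: otherwise a maximizing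
sequence would accumulate at an argmax where a density vanishes, but there the loss is
`0` or `∞`. -/
lemma exists_lower_bound_of_nearly_maximal {𝒳 : Type*} {f : 𝒳 → E d → ℝ} {C : Set (E d)}
    (hC2 : CondC2 f C) {x x' : 𝒳} (hf : Continuous (f x)) (hg : Continuous (f x'))
    (hf0 : ∀ t, 0 ≤ f x t) (hg0 : ∀ t, 0 ≤ f x' t)
    (hpos : 0 < maxLoss (f x) (f x') C) (hfin : maxLoss (f x) (f x') C ≠ ∞) :
    ∃ η δ : ℝ, 0 < η ∧ 0 < δ ∧ ∀ t ∈ C,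
      (maxLoss (f x) (f x') C).toReal - η < (loss (f x) (f x') t).toReal →
        δ ≤ f x t ∧ δ ≤ f x' t := by
  by_contra hcon
  push Not at hcon
  have hk : ∀ k : ℕ, ∃ t ∈ C, (maxLoss (f x) (f x') C).toReal - 1 / ((k : ℝ) + 1) <
      (loss (f x) (f x') t).toReal ∧ min (f x t) (f x' t) ≤ 1 / ((k : ℝ) + 1) := fun k => by
    obtain ⟨t, ht, h1, h2⟩ := hcon (1 / ((k : ℝ) + 1)) (1 / ((k : ℝ) + 1)) (by positivity)
      (by positivity)
    refine ⟨t, ht, h1, ?_⟩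
    by_cases h3 : 1 / ((k : ℝ) + 1) ≤ f x t
    · exact (min_le_right _ _).trans (h2 h3).le
    · exact (min_le_left _ _).trans (not_le.1 h3).le
  choose u huC hu1 hu2 using hk
  have hinv := tendsto_one_div_add_atTop_nhds_zero_nat (𝕜 := ℝ)
  have hmax : Tendsto (fun k => loss (f x) (f x') (u k)) atTop
      (𝓝 (maxLoss (f x) (f x') C)) := by
    rw [← ENNReal.tendsto_toReal_iff
      (fun k => ne_top_of_le_ne_top hfin (loss_le_maxLoss _ _ (huC k))) hfin]
    refine tendsto_of_tendsto_of_tendsto_of_le_of_le ?_ tendsto_const_nhds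
      (fun k => (hu1 k).le)
      fun k => ENNReal.toReal_mono hfin (loss_le_maxLoss _ _ (huC k))
    simpa using hinv.const_sub (maxLoss (f x) (f x') C).toReal
  obtain ⟨t, ht, hclu⟩ := hC2 x x' u huC hmax
  have hmin : Tendsto (fun k => min (f x (u k)) (f x' (u k))) atTop (𝓝 0) :=
    squeeze_zero (fun k => le_min (hf0 _) (hg0 _)) hu2 hinv
  have hclu' : MapClusterPt (min (f x t) (f x' t)) atTop
      fun k => min (f x (u k)) (f x' (u k)) :=
    hclu.continuousAt_comp (hf.min hg).continuousAt
  have h0 : min (f x t) (f x' t) = 0 := by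
    have : (𝓝 (min (f x t) (f x' t)) ⊓ 𝓝 0).NeBot := NeBot.mono hclu' (inf_le_inf_left _ hmin)
    exact eq_of_nhds_neBot this
  have hzero := (loss_toReal_of_maxLoss_ne_top hfin ht.1).2
  have hboth : f x t = 0 ∧ f x' t = 0 := by
    rcases min_choice (f x t) (f x' t) with h | h <;> rw [h] at h0
    · exact ⟨h0, hzero.1 h0⟩
    · exact ⟨hzero.2 h0, h0⟩
  have := ht.loss_eq_maxLoss
  rw [loss, logDist, if_pos hboth] at this
  exact hpos.ne this

lemma exists_loss_eq_maxLoss {𝒳 : Type*} {f : 𝒳 → E d → ℝ} {C : Set (E d)} (hC2 : CondC2 f C)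
    (hC : C.Nonempty) (x x' : 𝒳) :
    ∃ t ∈ C, loss (f x) (f x') t = maxLoss (f x) (f x') C := by
  obtain ⟨v, -, hv, hvC⟩ := exists_seq_tendsto_sSup (hC.image (loss (f x) (f x')))
    (OrderTop.bddAbove _)
  choose u huC hu using hvC
  rw [sSup_image] at hv
  obtain ⟨t, ht, -⟩ := hC2 x x' u huC (hv.congr fun n => (hu n).symm)
  exact ⟨t, ht.1, ht.loss_eq_maxLoss⟩

variable {Ω : Type*} [MeasurableSpace Ω] {P : Measure Ω} [IsProbabilityMeasure P]

/-- The kernel density estimators of both densities are simultaneously precise on `C`. -/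
lemma isHighProb_kde {K f g : E d → ℝ} {C : Set (E d)} {h h' τ : ℕ → ℝ}
    {X Y : (n : ℕ) → Fin n → Ω → E d} (hK : IsKernel K) (hC : Bornology.IsBounded C)
    (hf : Continuous f) (hg : Continuous g) (hf0 : ∀ t, 0 ≤ f t) (hg0 : ∀ t, 0 ≤ g t)
    [IsProbabilityMeasure (densityMeasure f)] [IsProbabilityMeasure (densityMeasure g)]
    (hβ : 0 < β) (hβ1 : β ≤ 1) {L L' : ℝ≥0} (hL : HolderWith L β f) (hL' : HolderWith L' β g)
    (hC3 : CondC3 d β h h' τ)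
    (hXY : ∀ n, IsSamplePair P (densityMeasure f) (densityMeasure g) (X n) (Y n)) :
    IsHighProb P fun n M => {ω | ∀ t ∈ C,
      |kde K (fun i => X n i ω) (h n) t - f t| ≤ M * contRate d β n ∧
      |kde K (fun i => Y n i ω) (h' n) t - g t| ≤ M * contRate d β n} := by
  intro δ hδ
  obtain ⟨M₁, hM₁, h1⟩ := exists_tendsto_measure_kde_deviation hK hf hf0 hβ hβ1 hL hC hC3.h_pos
    hC3.h_order (fun n => (hXY n).measurable_fst) (fun n => (hXY n).law_fst)
    fun n => (hXY n).indep_fst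
  obtain ⟨M₂, hM₂, h2⟩ := exists_tendsto_measure_kde_deviation hK hg hg0 hβ hβ1 hL' hC
    hC3.h'_pos hC3.h'_order (fun n => (hXY n).measurable_snd) (fun n => (hXY n).law_snd)
    fun n => (hXY n).indep_snd
  refine ⟨max M₁ M₂, lt_max_of_lt_left hM₁, ?_⟩
  have h12 := h1.add h2
  rw [add_zero] at h12
  filter_upwards [h12.eventually_le_const (ENNReal.ofReal_pos.2 hδ)] with n hn
  refine (measure_mono fun ω hω => ?_).trans ((measure_union_le _ _).trans hn)
  by_contra hcon
  simp only [Set.mem_union, Set.mem_ofPred_eq, not_or, not_exists, not_and, not_lt] at hcon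
  have hr := contRate_nonneg d β n
  refine hω fun t ht => ⟨(hcon.1 t ht).trans ?_, (hcon.2 t ht).trans ?_⟩
  · gcongr
    exact le_max_left _ _
  · gcongr
    exact le_max_right _ _

end Continuous

end LocalDP

/-! ### Estimation of the maximum loss -/

open LocalDP in
theorem proposition1 {m : ℕ} {𝒟 Ω : Type*} [MeasurableSpace Ω]
    (P : Measure Ω) [IsProbabilityMeasure P] (x x' : Fin m → 𝒟) :
    -- discrete algorithms
    (∀ (A : (Fin m → 𝒟) → Measure ℕ) (C : Set ℕ) (τ : ℕ → ℝ)
        (X Y : (n : ℕ) → Fin n → Ω → ℕ) (that : ℕ → Ω → ℕ),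
      (∀ z, IsProbabilityMeasure (A z)) →
      IsClosed C → Bornology.IsBounded C →
      CondD τ →
      (∀ n, IsSamplePair P (A x) (A x') (X n) (Y n)) →
      let empL : ℕ → Ω → ℕ → ℝ := fun n ω =>
        empLoss (tdde (fun i => X n i ω) (τ n)) (tdde (fun i => Y n i ω) (τ n))
      (∀ n ω, IsArgmaxOn (empL n ω) C (that n ω)) →
      let f := discreteDensity A
      let ε : ℝ≥0∞ := maxLoss (f x) (f x') C
      let εhat : ℕ → Ω → ℝ := fun n ω => empL n ω (that n ω)
      (0 < ε ∧ ε < ∞ →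
        IsBigOP P (fun n ω => |εhat n ω - ε.toReal|)
          (fun n => (n : ℝ) ^ (-(1 / 2) : ℝ)) ∧
        IsBigOP P (fun n ω => |(loss (f x) (f x') (that n ω)).toReal - ε.toReal|)
          (fun n => (n : ℝ) ^ (-(1 / 2) : ℝ))) ∧
      (ε = 0 → TendstoInMeasure P εhat atTop (fun _ => 0)) ∧
      (ε = ∞ → TendstoInProbTop P εhat)) ∧
    -- continuous algorithms
    (∀ (d : ℕ) (β : ℝ≥0) (A : (Fin m → 𝒟) → Measure (E d)) (f : (Fin m → 𝒟) → E d → ℝ)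
        (C : Set (E d)) (K : E d → ℝ) (h h' τ : ℕ → ℝ)
        (X Y : (n : ℕ) → Fin n → Ω → E d) (that : ℕ → Ω → E d),
      (∀ z, IsProbabilityMeasure (A z)) →
      IsContinuousAlgorithm A f →
      IsClosed C → Bornology.IsBounded C →
      IsKernel K →
      CondC1 f β → CondC2 f C → CondC3 d β h h' τ →
      (∀ n, IsSamplePair P (A x) (A x') (X n) (Y n)) →
      let empL : ℕ → Ω → E d → ℝ := fun n ω =>
        empLoss (tkde K (fun i => X n i ω) (h n) (τ n))
          (tkde K (fun i => Y n i ω) (h' n) (τ n))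
      (∀ n ω, IsArgmaxOn (empL n ω) C (that n ω)) →
      let ε : ℝ≥0∞ := maxLoss (f x) (f x') C
      let εhat : ℕ → Ω → ℝ := fun n ω => empL n ω (that n ω)
      (0 < ε ∧ ε < ∞ →
        IsBigOP P (fun n ω => |εhat n ω - ε.toReal|) (contRate d β) ∧
        IsBigOP P (fun n ω => |(loss (f x) (f x') (that n ω)).toReal - ε.toReal|)
          (contRate d β)) ∧
      (ε = 0 → TendstoInMeasure P εhat atTop (fun _ => 0)) ∧
      (ε = ∞ → TendstoInProbTop P εhat)) := by
  constructor
  · intro A C τ X Y that hA hCc hCb hD hXY empL harg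
    have := hA x
    have := hA x'
    have hfin : C.Finite := (Metric.isCompact_of_isClosed_isBounded hCc hCb).finite_of_discrete
    obtain ⟨ω₀⟩ := nonempty_of_isProbabilityMeasure P
    have hf0 : ∀ z t, 0 ≤ discreteDensity A z t := fun z t => measureReal_nonneg
    obtain ⟨δ₁, hδ₁, hlow₁⟩ := exists_pos_lower_bound hfin (discreteDensity A x)
    obtain ⟨δ₂, hδ₂, hlow₂⟩ := exists_pos_lower_bound hfin (discreteDensity A x')
    -- where the loss is finite, either both values are zero or both are bounded away from zero
    have hdich : maxLoss (discreteDensity A x) (discreteDensity A x') C ≠ ∞ → ∀ t ∈ C,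
        (discreteDensity A x t = 0 ∧ discreteDensity A x' t = 0) ∨
        (min δ₁ δ₂ ≤ discreteDensity A x t ∧ min δ₁ δ₂ ≤ discreteDensity A x' t) := by
      intro hε t ht
      have hz := (loss_toReal_of_maxLoss_ne_top hε ht).2
      by_cases h0 : discreteDensity A x t = 0
      · exact Or.inl ⟨h0, hz.1 h0⟩
      · exact Or.inr ⟨(min_le_left _ _).trans (hlow₁ t ht ((hf0 x t).lt_of_ne' h0)),
          (min_le_right _ _).trans (hlow₂ t ht ((hf0 x' t).lt_of_ne' fun h => h0 (hz.2 h)))⟩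
    have hδ : 0 < min δ₁ δ₂ := lt_min hδ₁ hδ₂
    have ha : Tendsto (fun n : ℕ => (n : ℝ) ^ (-(1 / 2) : ℝ)) atTop (𝓝 0) :=
      (tendsto_rpow_neg_atTop one_half_pos).comp tendsto_natCast_atTop_atTop
    have hτ := tendsto_floor_of_condD hD
    refine empLoss_argmax_asymptotics (hf0 x) (hf0 x')
      (fh := fun n ω => freq fun i => X n i ω) (gh := fun n ω => freq fun i => Y n i ω)
      (isHighProb_freqEvent hXY hfin.toFinset) ?_ ha hD.1 hτ ?_ ?_ ?_ ?_ ?_ harg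
    · filter_upwards [eventually_gt_atTop 0] with n hn
      positivity
    · intro M _ n ω hω t ht
      obtain ⟨h1, h2⟩ := hω t (hfin.mem_toFinset.2 ht)
      exact ⟨h1.1, h2.1⟩
    · intro M _
      refine Eventually.of_forall fun n ω hω t ht => ?_
      obtain ⟨h1, h2⟩ := hω t (hfin.mem_toFinset.2 ht)
      exact ⟨fun h => (h1.2 h).le.trans (hD.1 n).le, fun h => (h2.2 h).le.trans (hD.1 n).le⟩
    · intro hε M _ c hc
      have hMa : Tendsto (fun n : ℕ => M * (n : ℝ) ^ (-(1 / 2) : ℝ)) atTop (𝓝 0) := by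
        simpa using ha.const_mul M
      have h4 : Tendsto (fun n : ℕ => 4 / min δ₁ δ₂ * (M * (n : ℝ) ^ (-(1 / 2) : ℝ))) atTop
          (𝓝 0) := by
        simpa using hMa.const_mul (4 / min δ₁ δ₂)
      filter_upwards [h4.eventually_le_const hc, hMa.eventually_le_const (half_pos hδ),
        hτ.eventually_le_const (half_pos hδ)] with n h1 h2 h3 ω hω t ht
      obtain ⟨c1, c2⟩ := hω t (hfin.mem_toFinset.2 ht)
      rcases hdich hε t ht with ⟨hz, hz'⟩ | ⟨hp, hp'⟩
      · rw [empLoss, c1.2 hz, c2.2 hz', sub_self, abs_zero]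
        exact add_nonneg ENNReal.toReal_nonneg hc.le
      · rw [(loss_toReal_of_maxLoss_ne_top hε ht).1]
        have := (abs_le.1 (abs_abs_log_max_sub_le hδ hp hp' h2 h3 c1.1 c2.1)).2
        rw [empLoss]
        linarith
    · obtain ⟨t, ht, hmax⟩ := hfin.exists_maximalFor
        (loss (discreteDensity A x) (discreteDensity A x')) C ⟨_, (harg 0 ω₀).1⟩
      refine ⟨t, ht, IsArgmaxOn.loss_eq_maxLoss ⟨ht, fun s hs => ?_⟩⟩
      exact (le_total _ _).elim id fun h => hmax hs h
    · intro hpos hε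
      refine ⟨_, _, ENNReal.toReal_pos hpos.ne' hε, hδ, fun t ht hlt => ?_⟩
      rcases hdich hε t ht with ⟨hz, hz'⟩ | h
      · rw [sub_self, (loss_toReal_of_maxLoss_ne_top hε ht).1, hz, hz', sub_self, abs_zero] at hlt
        exact absurd hlt (lt_irrefl _)
      · exact h
  · intro d β A f C K h h' τ X Y that hA hf _ hCb hK hC1 hC2 hC3 hXY empL harg
    obtain ⟨hβ, hβ1, hHol⟩ := hC1
    obtain ⟨L, hL⟩ := hHol x
    obtain ⟨L', hL'⟩ := hHol x'
    have hp : ∀ z, IsProbabilityMeasure (densityMeasure (f z)) := fun z => by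
      have := hA z
      rwa [hf.law_eq z] at this
    have := hp x
    have := hp x'
    obtain ⟨ω₀⟩ := nonempty_of_isProbabilityMeasure P
    have hXY' : ∀ n, IsSamplePair P (densityMeasure (f x)) (densityMeasure (f x')) (X n) (Y n) :=
      fun n => by
        have := hXY n
        rwa [hf.law_eq x, hf.law_eq x'] at this
    have hratio : ∀ M, Tendsto (fun n => M * contRate d β n / τ n) atTop (𝓝 0) := fun M => by
      simpa [mul_div_assoc] using hC3.τ_lower.tendsto_div_nhds_zero.const_mul M
    refine empLoss_argmax_asymptotics (hf.nonneg x) (hf.nonneg x')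
      (fh := fun n ω => kde K (fun i => X n i ω) (h n))
      (gh := fun n ω => kde K (fun i => Y n i ω) (h' n))
      (isHighProb_kde hK hCb (hf.continuous x) (hf.continuous x') (hf.nonneg x) (hf.nonneg x')
        hβ hβ1 hL hL' hC3 hXY')
      (eventually_contRate_pos d β) (tendsto_contRate d hβ) hC3.τ_pos
      (tendsto_floor_of_condC3 hβ hC3) (fun M _ n ω hω => hω) ?_ ?_
      (exists_loss_eq_maxLoss hC2 ⟨_, (harg 0 ω₀).1⟩ x x')
      (exists_lower_bound_of_nearly_maximal hC2 (hf.continuous x) (hf.continuous x')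
        (hf.nonneg x) (hf.nonneg x')) harg
    · intro M _
      filter_upwards [(hratio M).eventually_le_const one_pos] with n hn ω hω t ht
      rw [div_le_one (hC3.τ_pos n)] at hn
      obtain ⟨c1, c2⟩ := hω t ht
      constructor <;> intro hz
      · rw [hz, sub_zero] at c1
        exact (le_abs_self _).trans (c1.trans hn)
      · rw [hz, sub_zero] at c2
        exact (le_abs_self _).trans (c2.trans hn)
    · intro hε M _ c hc
      filter_upwards [(hratio M).eventually_le_const (half_pos hc)] with n hn ω hω t ht
      obtain ⟨h1, h2⟩ := loss_toReal_of_maxLoss_ne_top hε ht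
      obtain ⟨c1, c2⟩ := hω t ht
      have := abs_log_max_sub_log_max_le_add (hf.nonneg x t) (hf.nonneg x' t) h2 (hC3.τ_pos n)
        c1 c2
      rw [h1, empLoss]
      linarith
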